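/- A finite family of lines in $\mathbb{R}^2$ is in \emph{general position} if no three of the lines are concurrent, no two are parallel and none is vertical. A family of $n$ lines is \emph{in convex position} if it defines an $n$-cell, that is, if the complement of the union of the lines has a connected component whose boundary contains a nondegenerate segment from each of the $n$ lines (the component may be bounded or unbounded). Theorem. For every $n\ge 3$ there is a smallest number $ES_l(n)$ such that every finite family of at least $ES_l(n)$ lines in general position contains $n$ lines in convex position, and $$2\binom{n-4}{\lceil n/2\rceil-1}^2\le ES_l(n).$$ (For $n=3$, $\binom{-1}{1}$ is read as the generalized binomial coefficient $-1$.) If moreover $n\ge 4$, then $$ES_l(n)\le\binom{2n-4}{n-2}.$$ -/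

import Mathlib

/-- A line in the plane `ℝ²`: a one-dimensional affine subspace. -/
def IsLine (l : AffineSubspace ℝ (ℝ × ℝ)) : Prop :=
  (l : Set (ℝ × ℝ)).Nonempty ∧ Module.finrank ℝ l.direction = 1

/-- A line is vertical if its direction contains the vector `(0, 1)`. -/
def IsVertical (l : AffineSubspace ℝ (ℝ × ℝ)) : Prop :=
  ((0, 1) : ℝ × ℝ) ∈ l.direction

/-- A finite family of lines in general position: no line is vertical, no two are parallel, and
no three are concurrent. -/
structure GeneralPosition (F : Finset (AffineSubspace ℝ (ℝ × ℝ))) : Prop where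
  isLine : ∀ l ∈ F, IsLine l
  not_vertical : ∀ l ∈ F, ¬ IsVertical l
  not_parallel : ∀ l₁ ∈ F, ∀ l₂ ∈ F, l₁ ≠ l₂ → ¬ l₁.Parallel l₂
  not_concurrent : ∀ l₁ ∈ F, ∀ l₂ ∈ F, ∀ l₃ ∈ F, l₁ ≠ l₂ → l₁ ≠ l₃ → l₂ ≠ l₃ →
    ¬ ∃ p : ℝ × ℝ, p ∈ l₁ ∧ p ∈ l₂ ∧ p ∈ l₃

/-- The complement of the union of the lines of a family. -/
def lineComplement (F : Finset (AffineSubspace ℝ (ℝ × ℝ))) : Set (ℝ × ℝ) :=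
  {p | ∀ l ∈ F, p ∉ l}

/-- `P` is a connected component of the complement of the union of the lines. -/
def IsCell (F : Finset (AffineSubspace ℝ (ℝ × ℝ))) (P : Set (ℝ × ℝ)) : Prop :=
  ∃ p ∈ lineComplement F, P = connectedComponentIn (lineComplement F) p

/-- The boundary of `P` contains a (nondegenerate) segment of the line `l`. -/
def BoundaryHasSegmentOf (P : Set (ℝ × ℝ)) (l : AffineSubspace ℝ (ℝ × ℝ)) : Prop :=
  ∃ p q : ℝ × ℝ, p ≠ q ∧ segment ℝ p q ⊆ frontier P ∩ (l : Set (ℝ × ℝ))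

/-- The family `F` defines the `k`-cell `P`: it is a cell of `F` whose boundary contains a segment
from exactly `k` of the lines. -/
def DefinesCell (F : Finset (AffineSubspace ℝ (ℝ × ℝ))) (k : ℕ) (P : Set (ℝ × ℝ)) : Prop :=
  IsCell F P ∧ {l | l ∈ F ∧ BoundaryHasSegmentOf P l}.ncard = k

/-- A family of `n` lines is in convex position if it defines an `n`-cell. -/
def InConvexPosition (F : Finset (AffineSubspace ℝ (ℝ × ℝ))) : Prop :=
  ∃ P, DefinesCell F F.card P

/-- A family spans an `n`-cell if it contains `n` lines in convex position. -/
def SpansCell (F : Finset (AffineSubspace ℝ (ℝ × ℝ))) (n : ℕ) : Prop :=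
  ∃ G ⊆ F, G.card = n ∧ InConvexPosition G

/-- The numbers `N` such that every family of at least `N` lines in general position contains
`n` lines in convex position. -/
def sufficientSizes (n : ℕ) : Set ℕ :=
  {N | ∀ F : Finset (AffineSubspace ℝ (ℝ × ℝ)), GeneralPosition F → N ≤ F.card → SpansCell F n}

/-- The Erdős–Szekeres number for lines: the least element of `sufficientSizes n`. -/
noncomputable def ESl (n : ℕ) : ℕ := sInf (sufficientSizes n)

/-!
A non-vertical line `y = a * x + b` is the pair `(a, b)`. A family of lines in general position is in
convex position exactly if its members can be labelled `upper` and `lower` in such a way that every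
line has a point strictly below all other upper and strictly above all other lower lines
(`InConvexPosition.exists_boundsCell`, `BoundsCell.inConvexPosition`). On a line `l`, each other line
bounds the abscissa of such a point by the abscissa of its intersection with `l`, from above or from
below; so only comparisons between intersections on a common line matter (`boundsCell_iff`).

Upper bound. Sort the lines by slope and call a triple a cup if its middle line contributes to the
upper envelope, and a cap otherwise. Cups and caps of `n` lines bound `n`-cells, so the cups-caps
theorem of Erdős and Szekeres (`exists_cup_or_cap`) would give `(2n-4 choose n-2) + 1`. One line is
saved by rotating the plane so that the line of smallest slope becomes the line of largest slope.
The cups and caps of the rotated family bound `n`-cells as well (`boundsCell_insert_of_cup`,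
`boundsCell_insert_of_cap`). In the rotated family, the right ends of `(n-1)`-cups of the original
family together with the moved line contain no `(n-1)`-cap unless there is an `n`-cell; hence that
line can be counted in both parts of the recursion (`exists_cup_or_cap_of_shift`).

Lower bound. The lines are indexed by binary words, in such a way that slopes follow the
lexicographic order, and the abscissa of the intersection of two lines is, up to a small error, a
prescribed function (`slopeRank`) of the leading digit at which their words differ
(`BranchAt.abs_meet_sub_lt`). There are `n - 3` leading digits, for which `slopeRank` is larger for
higher digits, and below them `n - 4` digits, for which it is larger for lower digits and exceeds all
values of the former kind. So the lines form clusters, one for each pattern of leading digits, which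
are arranged like an extremal set of Erdős and Szekeres, each cluster being a mirrored such set, with
its intersections to the right of all others. Fixing the numbers of ones in the two blocks of digits
bounds cups and caps, one block at a time (`CellRules.exists_first`). For a cell with both upper lines
`C` and lower lines `D`, every triple is a cup or a cap according to the labels (`CellRules`). This
leaves room for large contributions of the leading digits, or of the remaining digits, but not of
both at the same time (`CellRules.card_le_of_cluster`), and the cell has fewer than `n` sides
(`CellRules.card_le`).
-/

/-! ### Lines as graphs of affine functions -/

/-- The value at `x` of the affine function `x ↦ a * x + b` encoded by the pair `l = (a, b)`. -/
def lineVal (l : ℝ × ℝ) (x : ℝ) : ℝ := l.1 * x + l.2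

/-- The non-vertical line `y = a * x + b` encoded by the pair `l = (a, b)`. -/
def graphLine (l : ℝ × ℝ) : AffineSubspace ℝ (ℝ × ℝ) :=
  AffineSubspace.mk' ((0, l.2) : ℝ × ℝ) (Submodule.span ℝ {((1, l.1) : ℝ × ℝ)})

theorem mem_graphLine {l p : ℝ × ℝ} : p ∈ graphLine l ↔ p.2 = lineVal l p.1 := by
  obtain ⟨a, b⟩ := l
  obtain ⟨x, y⟩ := p
  simp only [graphLine, AffineSubspace.mem_mk', Submodule.mem_span_singleton, lineVal,
    vsub_eq_sub, Prod.mk_sub_mk, Prod.smul_mk, smul_eq_mul, Prod.mk.injEq]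
  constructor
  · rintro ⟨c, h1, h2⟩
    have : c = x := by linarith
    subst this
    linarith
  · intro h
    exact ⟨x, by ring, by rw [h]; ring⟩

theorem graphLine_injective : Function.Injective graphLine := by
  intro l m h
  have key : ∀ x, lineVal l x = lineVal m x := fun x => by
    have : ((x, lineVal l x) : ℝ × ℝ) ∈ graphLine l := mem_graphLine.2 rfl
    rw [h] at this
    exact mem_graphLine.1 this
  have h0 := key 0
  have h1 := key 1
  simp only [lineVal] at h0 h1
  exact Prod.ext (by linarith) (by linarith)

theorem direction_graphLine (l : ℝ × ℝ) :
    (graphLine l).direction = Submodule.span ℝ {((1, l.1) : ℝ × ℝ)} :=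
  AffineSubspace.direction_mk' _ _

theorem isLine_graphLine (l : ℝ × ℝ) : IsLine (graphLine l) := by
  refine ⟨⟨(0, lineVal l 0), mem_graphLine.2 rfl⟩, ?_⟩
  rw [direction_graphLine]
  exact finrank_span_singleton (by simp)

theorem not_isVertical_graphLine (l : ℝ × ℝ) : ¬ IsVertical (graphLine l) := by
  rw [IsVertical, direction_graphLine, Submodule.mem_span_singleton]
  rintro ⟨c, hc⟩
  simp only [Prod.smul_mk, smul_eq_mul, Prod.mk.injEq] at hc
  obtain ⟨h1, h2⟩ := hc
  have : c = 0 := by linarith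
  subst this
  simp at h2

theorem graphLine_parallel_iff {l m : ℝ × ℝ} : (graphLine l).Parallel (graphLine m) ↔ l.1 = m.1 := by
  have hne : ∀ k, graphLine k ≠ ⊥ := fun k h => by
    have := (isLine_graphLine k).1
    rw [h] at this
    simp at this
  rw [AffineSubspace.parallel_iff_direction_eq_and_eq_bot_iff_eq_bot, direction_graphLine,
    direction_graphLine]
  constructor
  · rintro ⟨h, -⟩
    have : ((1, l.1) : ℝ × ℝ) ∈ Submodule.span ℝ {((1, m.1) : ℝ × ℝ)} := by
      rw [← h]; exact Submodule.mem_span_singleton_self _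
    obtain ⟨c, hc⟩ := Submodule.mem_span_singleton.1 this
    simp only [Prod.smul_mk, smul_eq_mul, Prod.mk.injEq] at hc
    obtain ⟨h1, h2⟩ := hc
    have : c = 1 := by linarith
    subst this
    linarith
  · intro h
    rw [h]
    simp [hne]

theorem exists_eq_graphLine {l : AffineSubspace ℝ (ℝ × ℝ)} (hl : IsLine l) (hv : ¬ IsVertical l) :
    ∃ m, graphLine m = l := by
  obtain ⟨⟨q, hq⟩, hr⟩ := hl
  obtain ⟨⟨⟨v₁, v₂⟩, hvd⟩, hv0, hspan⟩ := finrank_eq_one_iff'.1 hr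
  have h1 : v₁ ≠ 0 := by
    rintro rfl
    have h2 : v₂ ≠ 0 := by
      rintro rfl
      exact hv0 rfl
    apply hv
    have := l.direction.smul_mem v₂⁻¹ hvd
    simpa [IsVertical, h2] using this
  refine ⟨(v₂ / v₁, q.2 - v₂ / v₁ * q.1), ?_⟩
  ext p
  rw [mem_graphLine, lineVal]
  have hmem : p ∈ l ↔ p - q ∈ l.direction := by
    rw [← vsub_eq_sub, AffineSubspace.vsub_right_mem_direction_iff_mem hq]
  rw [hmem]
  constructor
  · intro h
    have := l.direction.smul_mem ((p.1 - q.1) / v₁) hvd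
    convert this using 1
    ext
    · simp; field_simp
    · simp [h]; field_simp; ring
  · intro h
    obtain ⟨c, hc⟩ := hspan ⟨p - q, h⟩
    have hc' : c • ((v₁, v₂) : ℝ × ℝ) = p - q := congrArg Subtype.val hc
    have e1 : c * v₁ = p.1 - q.1 := congrArg Prod.fst hc'
    have e2 : c * v₂ = p.2 - q.2 := congrArg Prod.snd hc'
    have h3 : p.1 = c * v₁ + q.1 := by linarith
    have h4 : p.2 = c * v₂ + q.2 := by linarith
    simp only
    rw [h3, h4]
    field_simp
    ring

/-! ### A combinatorial form of convex position -/

/-- `lineSide U m p` says that the point `p` lies strictly below the line `m` if `m ∈ U`, and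
strictly above it otherwise. -/
def lineSide (U : Set (ℝ × ℝ)) (m p : ℝ × ℝ) : Prop :=
  (m ∈ U → p.2 < lineVal m p.1) ∧ (m ∉ U → lineVal m p.1 < p.2)

/-- The lines of `S` bound a common cell, the lines of `U` from above and the others from below:
each line of `S` has a point that lies strictly on the prescribed side of all other lines. -/
def BoundsCell (S : Finset (ℝ × ℝ)) (U : Set (ℝ × ℝ)) : Prop :=
  ∀ l ∈ S, ∃ x, ∀ m ∈ S, m ≠ l → lineSide U m (x, lineVal l x)

theorem continuous_lineVal (m : ℝ × ℝ) : Continuous (lineVal m) := by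
  unfold lineVal; fun_prop

theorem isOpen_lineSide (U : Set (ℝ × ℝ)) (m : ℝ × ℝ) : IsOpen {p | lineSide U m p} := by
  have hc := continuous_lineVal m
  by_cases h : m ∈ U
  · simp only [lineSide, h, not_true, false_imp_iff, true_imp_iff, and_true]
    exact isOpen_lt continuous_snd (hc.comp continuous_fst)
  · simp only [lineSide, h, not_false_eq_true, false_imp_iff, true_imp_iff, true_and]
    exact isOpen_lt (hc.comp continuous_fst) continuous_snd

theorem convex_lineSide (U : Set (ℝ × ℝ)) (m : ℝ × ℝ) : Convex ℝ {p | lineSide U m p} := by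
  intro p hp q hq a b ha hb hab
  have hb' : b = 1 - a := by linarith
  subst hb'
  simp only [Set.mem_ofPred_eq, lineSide, lineVal, Prod.fst_add, Prod.snd_add, Prod.smul_fst,
    Prod.smul_snd, smul_eq_mul] at *
  refine ⟨fun h => ?_, fun h => ?_⟩
  · have h1 := hp.1 h
    have h2 := hq.1 h
    rcases ha.eq_or_lt with rfl | ha
    · linarith
    · nlinarith
  · have h1 := hp.2 h
    have h2 := hq.2 h
    rcases ha.eq_or_lt with rfl | ha
    · linarith
    · nlinarith

theorem mem_lineComplement_image {S : Finset (ℝ × ℝ)} {p : ℝ × ℝ}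
    [DecidableEq (AffineSubspace ℝ (ℝ × ℝ))] :
    p ∈ lineComplement (S.image graphLine) ↔ ∀ m ∈ S, p.2 ≠ lineVal m p.1 := by
  constructor
  · intro h m hm hp
    exact h _ (Finset.mem_image_of_mem _ hm) (mem_graphLine.2 hp)
  · intro h l hl hp
    obtain ⟨m, hm, rfl⟩ := Finset.mem_image.1 hl
    exact h m hm (mem_graphLine.1 hp)

/-- Points in one component of the complement of the lines lie on the same side of each line. -/
theorem lineSide_of_mem_connectedComponentIn {S : Finset (ℝ × ℝ)} {U : Set (ℝ × ℝ)}
    [DecidableEq (AffineSubspace ℝ (ℝ × ℝ))] {p q m : ℝ × ℝ}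
    (hq : q ∈ connectedComponentIn (lineComplement (S.image graphLine)) p)
    (hm : m ∈ S) (hp : lineSide U m p) : lineSide U m q := by
  have hpc : p ∈ lineComplement (S.image graphLine) :=
    connectedComponentIn_nonempty_iff.1 ⟨q, hq⟩
  have hpp := mem_connectedComponentIn hpc
  have hcont : Continuous fun r : ℝ × ℝ => r.2 - lineVal m r.1 :=
    continuous_snd.sub ((continuous_lineVal m).comp continuous_fst)
  have hpre := (isPreconnected_connectedComponentIn (x := p)
    (F := lineComplement (S.image graphLine))).image _ hcont.continuousOn
  have hz : ∀ r ∈ connectedComponentIn (lineComplement (S.image graphLine)) p,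
      r.2 - lineVal m r.1 ≠ 0 := fun r hr =>
    sub_ne_zero.2 (mem_lineComplement_image.1 (connectedComponentIn_subset _ _ hr) m hm)
  have hord := hpre.ordConnected
  refine ⟨fun h => ?_, fun h => ?_⟩
  · by_contra hlt
    obtain ⟨r, hr, hr0⟩ := hord.out (Set.mem_image_of_mem _ hpp) (Set.mem_image_of_mem _ hq)
      (show (0 : ℝ) ∈ _ from ⟨by have := hp.1 h; linarith,
        by linarith [not_lt.1 hlt]⟩)
    exact hz r hr hr0
  · by_contra hlt
    obtain ⟨r, hr, hr0⟩ := hord.out (Set.mem_image_of_mem _ hq) (Set.mem_image_of_mem _ hpp)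
      (show (0 : ℝ) ∈ _ from ⟨by linarith [not_lt.1 hlt],
        by have := hp.2 h; linarith⟩)
    exact hz r hr hr0

/-- The segment of `l` on the boundary of the cell can be taken through its midpoint: there no
other line can be met, as that line would cross the segment. -/
theorem InConvexPosition.exists_boundsCell {S : Finset (ℝ × ℝ)}
    [DecidableEq (AffineSubspace ℝ (ℝ × ℝ))] (h : InConvexPosition (S.image graphLine)) :
    ∃ U, BoundsCell S U := by
  obtain ⟨P, ⟨⟨p₀, hp₀, rfl⟩, hcard⟩⟩ := h
  set F := S.image graphLine with hF
  set P := connectedComponentIn (lineComplement F) p₀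
  have hall : ∀ l ∈ S, BoundaryHasSegmentOf P (graphLine l) := by
    have hsub : {l | l ∈ F ∧ BoundaryHasSegmentOf P l} ⊆ (F : Set _) := fun l hl => hl.1
    have heq := Set.eq_of_subset_of_ncard_le hsub
      (by rw [hcard, Set.ncard_coe_finset]) F.finite_toSet
    intro l hl
    have : graphLine l ∈ (F : Set _) := by
      rw [hF]; exact_mod_cast Finset.mem_image_of_mem _ hl
    rw [← heq] at this
    exact this.2
  refine ⟨{m | p₀.2 < lineVal m p₀.1}, fun l hl => ?_⟩
  obtain ⟨p, q, hpq, hseg⟩ := hall l hl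
  have hp := hseg (left_mem_segment ℝ p q)
  have hq := hseg (right_mem_segment ℝ p q)
  have hpl := mem_graphLine.1 hp.2
  have hql := mem_graphLine.1 hq.2
  have hne : p.1 ≠ q.1 := fun h => hpq (Prod.ext h (by rw [hpl, hql, h]))
  refine ⟨(p.1 + q.1) / 2, fun m hm hml => ?_⟩
  have hside : ∀ r ∈ P, lineSide {m | p₀.2 < lineVal m p₀.1} m r := fun r hr =>
    lineSide_of_mem_connectedComponentIn hr hm
      ⟨fun h => h, fun h => lt_of_le_of_ne (not_lt.1 h) (mem_lineComplement_image.1 hp₀ m hm).symm⟩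
  have hcm := continuous_lineVal m
  by_cases hU : p₀.2 < lineVal m p₀.1
  · have hcl : closure P ⊆ {r | r.2 ≤ lineVal m r.1} :=
      closure_minimal (fun r hr => ((hside r hr).1 hU).le)
        (isClosed_le continuous_snd (hcm.comp continuous_fst))
    have h1 : p.2 ≤ lineVal m p.1 := hcl (frontier_subset_closure hp.1)
    have h2 : q.2 ≤ lineVal m q.1 := hcl (frontier_subset_closure hq.1)
    refine ⟨fun _ => ?_, fun h => absurd hU h⟩
    by_contra hcon
    apply hml
    simp only [lineVal] at *
    have e1 : p.2 = m.1 * p.1 + m.2 := by linarith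
    have e2 : q.2 = m.1 * q.1 + m.2 := by linarith
    have : (m.1 - l.1) * (p.1 - q.1) = 0 := by linarith
    have hs : m.1 = l.1 := by
      rcases mul_eq_zero.1 this with h | h
      · linarith
      · exact absurd (by linarith) hne
    exact Prod.ext hs (by rw [hs] at e1; linarith)
  · have hcl : closure P ⊆ {r | lineVal m r.1 ≤ r.2} :=
      closure_minimal (fun r hr => ((hside r hr).2 hU).le)
        (isClosed_le (hcm.comp continuous_fst) continuous_snd)
    have h1 : lineVal m p.1 ≤ p.2 := hcl (frontier_subset_closure hp.1)
    have h2 : lineVal m q.1 ≤ q.2 := hcl (frontier_subset_closure hq.1)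
    refine ⟨fun h => absurd h hU, fun _ => ?_⟩
    by_contra hcon
    apply hml
    simp only [lineVal] at *
    have e1 : p.2 = m.1 * p.1 + m.2 := by linarith
    have e2 : q.2 = m.1 * q.1 + m.2 := by linarith
    have : (m.1 - l.1) * (p.1 - q.1) = 0 := by linarith
    have hs : m.1 = l.1 := by
      rcases mul_eq_zero.1 this with h | h
      · linarith
      · exact absurd (by linarith) hne
    exact Prod.ext hs (by rw [hs] at e1; linarith)

theorem BoundsCell.inConvexPosition {S : Finset (ℝ × ℝ)} {U : Set (ℝ × ℝ)}
    [DecidableEq (AffineSubspace ℝ (ℝ × ℝ))] (hS : S.Nonempty) (h : BoundsCell S U) :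
    InConvexPosition (S.image graphLine) := by
  set P : Set (ℝ × ℝ) := ⋂ m ∈ S, {p | lineSide U m p} with hP
  have hPopen : IsOpen P := isOpen_biInter_finset fun m _ => isOpen_lineSide U m
  have hPconv : Convex ℝ P := convex_iInter₂ fun m _ => convex_lineSide U m
  have hPc : P ⊆ lineComplement (S.image graphLine) := by
    intro p hp
    rw [mem_lineComplement_image]
    intro m hm heq
    have := Set.mem_iInter₂.1 hp m hm
    by_cases hU : m ∈ U
    · exact (this.1 hU).ne heq
    · exact (this.2 hU).ne' heq
  -- a point of `l` on the prescribed side of the other lines is a limit of points of the cell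
  have hclosure : ∀ l ∈ S, ∀ p : ℝ × ℝ, p.2 = lineVal l p.1 →
      (∀ m ∈ S, m ≠ l → lineSide U m p) → p ∈ closure P := by
    intro l hl p hpl hp
    have hO : IsOpen (⋂ m ∈ S.erase l, {p | lineSide U m p}) :=
      isOpen_biInter_finset fun m _ => isOpen_lineSide U m
    have hpO : p ∈ ⋂ m ∈ S.erase l, {p | lineSide U m p} := by
      refine Set.mem_iInter₂.2 fun m hm => ?_
      exact hp m (Finset.mem_of_mem_erase hm) (Finset.ne_of_mem_erase hm)
    obtain ⟨ε, hε⟩ : ∃ ε : ℝ, ∀ t : ℝ, 0 < t → lineSide U l (p + t • (0, ε)) := by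
      by_cases hU : l ∈ U
      · refine ⟨-1, fun t ht => ⟨fun _ => ?_, fun h => absurd hU h⟩⟩
        simp [hpl]; linarith
      · refine ⟨1, fun t ht => ⟨fun h => absurd h hU, fun _ => ?_⟩⟩
        simp [hpl]; linarith
    have hlim : Filter.Tendsto (fun t : ℝ => p + t • ((0, ε) : ℝ × ℝ)) (nhdsWithin 0 (Set.Ioi 0))
        (nhds p) := by
      have : Continuous fun t : ℝ => p + t • ((0, ε) : ℝ × ℝ) := by fun_prop
      simpa using (this.tendsto 0).mono_left nhdsWithin_le_nhds
    refine mem_closure_of_tendsto hlim ?_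
    filter_upwards [hlim.eventually (hO.mem_nhds hpO), self_mem_nhdsWithin] with t ht ht0
    refine Set.mem_iInter₂.2 fun m hm => ?_
    rcases eq_or_ne m l with rfl | hne
    · exact hε t ht0
    · exact Set.mem_iInter₂.1 ht m (Finset.mem_erase.2 ⟨hne, hm⟩)
  have hPne : P.Nonempty := by
    obtain ⟨l, hl⟩ := hS
    obtain ⟨x, hx⟩ := h l hl
    exact closure_nonempty_iff.1 ⟨_, hclosure l hl _ rfl hx⟩
  obtain ⟨p₀, hp₀⟩ := hPne
  refine ⟨P, ⟨p₀, hPc hp₀, ?_⟩, ?_⟩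
  · refine Set.Subset.antisymm
      (hPconv.isPreconnected.subset_connectedComponentIn hp₀ hPc) fun q hq => ?_
    refine Set.mem_iInter₂.2 fun m hm => ?_
    exact lineSide_of_mem_connectedComponentIn hq hm (Set.mem_iInter₂.1 hp₀ m hm)
  · have : {l | l ∈ S.image graphLine ∧ BoundaryHasSegmentOf P l} = (S.image graphLine : Set _) := by
      refine Set.Subset.antisymm (fun l hl => hl.1) fun l hl => ⟨hl, ?_⟩
      obtain ⟨l, hlS, rfl⟩ := Finset.mem_image.1 (Finset.mem_coe.1 hl)
      obtain ⟨x, hx⟩ := h l hlS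
      have hO : IsOpen {y : ℝ | ∀ m ∈ S.erase l, lineSide U m (y, lineVal l y)} := by
        have : {y : ℝ | ∀ m ∈ S.erase l, lineSide U m (y, lineVal l y)} =
            ⋂ m ∈ S.erase l, (fun y : ℝ => (y, lineVal l y)) ⁻¹' {p | lineSide U m p} := by
          ext; simp
        rw [this]
        refine isOpen_biInter_finset fun m _ => (isOpen_lineSide U m).preimage ?_
        exact continuous_id.prodMk (continuous_lineVal l)
      obtain ⟨ε, hε, hball⟩ := Metric.isOpen_iff.1 hO x fun m hm =>
        hx m (Finset.mem_of_mem_erase hm) (Finset.ne_of_mem_erase hm)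
      refine ⟨(x, lineVal l x), (x + ε / 2, lineVal l (x + ε / 2)), ?_, fun p hp => ?_⟩
      · intro heq
        have := congrArg Prod.fst heq
        simp only at this
        linarith
      obtain ⟨a, b, ha, hb, hab, rfl⟩ := hp
      have hb' : b ≤ 1 := by linarith
      have hp1 : a • ((x, lineVal l x) : ℝ × ℝ) + b • (x + ε / 2, lineVal l (x + ε / 2)) =
          (x + b * (ε / 2), lineVal l (x + b * (ε / 2))) := by
        have ha' : a = 1 - b := by linarith
        subst ha'
        ext
        · simp; ring
        · simp [lineVal]; ring
      rw [hp1]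
      have hmem := hball (show x + b * (ε / 2) ∈ Metric.ball x ε by
        rw [Metric.mem_ball, Real.dist_eq, add_sub_cancel_left, abs_of_nonneg (by positivity)]
        nlinarith)
      refine ⟨?_, mem_graphLine.2 rfl⟩
      rw [hPopen.frontier_eq]
      refine ⟨hclosure l hlS _ rfl fun m hm hne => hmem m (Finset.mem_erase.2 ⟨hne, hm⟩),
        fun hmemP => ?_⟩
      exact mem_lineComplement_image.1 (hPc hmemP) l hlS rfl
    rw [this, Set.ncard_coe_finset]

/-! ### Cups and caps for transitive triple relations -/

section CupsCaps

variable {α : Type*} [LinearOrder α]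

/-- All increasing triples of `A` satisfy the relation `T`. If `T` says that three points make a left
turn, these are the cups of Erdős and Szekeres; for the negation of `T` they are the caps. -/
def IsCup (T : α → α → α → Prop) (A : Finset α) : Prop :=
  ∀ x ∈ A, ∀ y ∈ A, ∀ z ∈ A, x < y → y < z → T x y z

/-- The triple relation `T` is transitive on `S`: whether an increasing sequence is a cup can be
read off from its consecutive triples. -/
def TripleTrans (T : α → α → α → Prop) (S : Set α) : Prop :=
  ∀ a ∈ S, ∀ b ∈ S, ∀ c ∈ S, ∀ d ∈ S, a < b → b < c → c < d → T a b c → T b c d →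
    T a b d ∧ T a c d

/-- A cup with last two elements `a < q` can be prolonged by any `b > q` for which `a, q, b` is
a cup. -/
theorem IsCup.insert_right {T : α → α → α → Prop} {S : Set α} (hT : TripleTrans T S)
    {A : Finset α} (hAS : (A : Set α) ⊆ S) (hA : IsCup T A) {a q b : α} (ha : a ∈ A) (hq : q ∈ A)
    (haq : a < q) (hmax : ∀ x ∈ A, x ≤ q) (hmax' : ∀ x ∈ A, x < q → x ≤ a) (hbS : b ∈ S)
    (hqb : q < b) (h : T a q b) : IsCup T (insert b A) := by
  have h1 : ∀ x ∈ A, x < q → T x q b := fun x hx hxq => by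
    rcases (hmax' x hx hxq).eq_or_lt with rfl | hxa
    · exact h
    · exact (hT x (hAS hx) a (hAS ha) q (hAS hq) b hbS hxa haq hqb (hA x hx a ha q hq hxa haq) h).2
  have h2 : ∀ x ∈ A, ∀ y ∈ A, x < y → T x y b := fun x hx y hy hxy => by
    rcases (hmax y hy).eq_or_lt with rfl | hyq
    · exact h1 x hx hxy
    · exact (hT x (hAS hx) y (hAS hy) q (hAS hq) b hbS hxy hyq hqb
        (hA x hx y hy q hq hxy hyq) (h1 y hy hyq)).1
  have hlt : ∀ x ∈ A, x < b := fun x hx => (hmax x hx).trans_lt hqb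
  intro x hx y hy z hz hxy hyz
  rw [Finset.mem_insert] at hx hy hz
  rcases hy with rfl | hy
  · rcases hz with rfl | hz
    · exact absurd hyz (lt_irrefl _)
    · exact absurd (hlt z hz) hyz.not_gt
  rcases hx with rfl | hx
  · exact absurd (hlt y hy) hxy.not_gt
  rcases hz with rfl | hz
  · exact h2 x hx y hy hxy
  · exact hA x hx y hy z hz hxy hyz

theorem IsCup.insert_left {T : α → α → α → Prop} {S : Set α} (hT : TripleTrans T S)
    {A : Finset α} (hAS : (A : Set α) ⊆ S) (hA : IsCup T A) {a q b : α} (hb : b ∈ A) (hq : q ∈ A)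
    (hqb : q < b) (hmin : ∀ x ∈ A, q ≤ x) (hmin' : ∀ x ∈ A, q < x → b ≤ x) (haS : a ∈ S)
    (haq : a < q) (h : T a q b) : IsCup T (insert a A) := by
  have key := IsCup.insert_right (α := αᵒᵈ) (T := fun x y z : α => T z y x) (S := S)
    (fun x hx y hy z hz w hw hxy hyz hzw h1 h2 =>
      (hT w hw z hz y hy x hx hzw hyz hxy h2 h1).symm)
    (A := A) hAS (fun x hx y hy z hz hxy hyz => hA z hz y hy x hx hyz hxy) hb hq hqb hmin hmin' haS
    haq h
  intro x hx y hy z hz hxy hyz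
  have hins : ∀ w ∈ insert a A, w ∈ @insert αᵒᵈ (Finset αᵒᵈ) _ a A := fun w hw =>
    Finset.mem_insert.2 (Finset.mem_insert.1 hw)
  exact key z (hins z hz) y (hins y hy) x (hins x hx) hyz hxy

/-- The last two elements of a finite set. -/
theorem Finset.exists_last_two {A : Finset α} (hA : 2 ≤ A.card) : ∃ a ∈ A, ∃ q ∈ A, a < q ∧
    (∀ x ∈ A, x ≤ q) ∧ ∀ x ∈ A, x < q → x ≤ a := by
  have hne : A.Nonempty := Finset.card_pos.1 (by omega)
  have hq := A.max'_mem hne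
  have hne' : (A.erase (A.max' hne)).Nonempty :=
    Finset.card_pos.1 (by rw [Finset.card_erase_of_mem hq]; omega)
  have ha := (A.erase (A.max' hne)).max'_mem hne'
  rw [Finset.mem_erase] at ha
  refine ⟨_, ha.2, _, hq, lt_of_le_of_ne (A.le_max' _ ha.2) ha.1, fun x hx => A.le_max' x hx,
    fun x hx hxq => Finset.le_max' _ _ (Finset.mem_erase.2 ⟨hxq.ne, hx⟩)⟩

theorem Finset.exists_first_two {A : Finset α} (hA : 2 ≤ A.card) : ∃ b ∈ A, ∃ q ∈ A, q < b ∧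
    (∀ x ∈ A, q ≤ x) ∧ ∀ x ∈ A, q < x → b ≤ x :=
  Finset.exists_last_two (α := αᵒᵈ) hA

/-- The cups-caps theorem of Erdős and Szekeres. -/
theorem exists_cup_or_cap (T : α → α → α → Prop) (k l : ℕ) (S : Finset α)
    (hT : TripleTrans T S) (hT' : TripleTrans (fun x y z => ¬ T x y z) S)
    (hS : (k + l).choose k < S.card) :
    (∃ A ⊆ S, A.card = k + 2 ∧ IsCup T A) ∨
      ∃ A ⊆ S, A.card = l + 2 ∧ IsCup (fun x y z => ¬ T x y z) A := by
  classical
  -- two elements form both a cup and a cap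
  have htwo : ∀ (T : α → α → α → Prop) (S : Finset α), 1 < S.card →
      ∃ A ⊆ S, A.card = 2 ∧ IsCup T A := fun T S hS => by
    obtain ⟨A, hAS, hA⟩ := Finset.exists_subset_card_eq (show 2 ≤ S.card from hS)
    refine ⟨A, hAS, hA, fun x hx y hy z hz hxy hyz => ?_⟩
    have := Finset.card_le_card (show {x, y, z} ⊆ A by
      intro w hw; simp only [Finset.mem_insert, Finset.mem_singleton] at hw
      rcases hw with rfl | rfl | rfl <;> assumption)
    rw [Finset.card_eq_three.2 ⟨x, y, z, hxy.ne, (hxy.trans hyz).ne, hyz.ne, rfl⟩] at this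
    omega
  induction hm : k + l generalizing k l S with
  | zero =>
    obtain rfl : k = 0 := by omega
    exact Or.inl (htwo T S (by simpa using hS))
  | succ m ih =>
    rcases k with _ | k
    · exact Or.inl (htwo T S (by simpa using hS))
    rcases l with _ | l
    · exact Or.inr (htwo _ S (by simpa using hS))
    set Y := S.filter fun q => ∃ A ⊆ S, A.card = k + 2 ∧ IsCup T A ∧ q ∈ A ∧ ∀ x ∈ A, x ≤ q with hY
    have hYS : Y ⊆ S := Finset.filter_subset _ _
    have hsum : (S \ Y).card + Y.card = S.card := Finset.card_sdiff_add_card_eq_card hYS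
    have hpas : (k + 1 + (l + 1)).choose (k + 1) =
        (k + (l + 1)).choose k + (k + 1 + l).choose (k + 1) := by
      rw [show k + 1 + (l + 1) = (k + l + 1) + 1 by ring, Nat.choose_succ_succ,
        show k + (l + 1) = k + l + 1 by ring, show k + 1 + l = k + l + 1 by ring]
    have hsubT : ∀ {T : α → α → α → Prop} {S' : Finset α}, S' ⊆ S → TripleTrans T (S : Set α) →
        TripleTrans T (S' : Set α) := fun hs h a ha b hb c hc d hd =>
      h a (hs ha) b (hs hb) c (hs hc) d (hs hd)
    by_cases hcase : (k + (l + 1)).choose k < (S \ Y).card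
    · rcases ih k (l + 1) (S \ Y) (hsubT Finset.sdiff_subset hT) (hsubT Finset.sdiff_subset hT')
        hcase (by omega) with ⟨A, hAS, hAc, hA⟩ | ⟨A, hAS, hAc, hA⟩
      · obtain ⟨a, ha, q, hq, haq, hmax, -⟩ := Finset.exists_last_two (A := A) (by omega)
        have hqY : q ∈ Y := Finset.mem_filter.2 ⟨Finset.sdiff_subset (hAS hq), A,
          hAS.trans Finset.sdiff_subset, hAc, hA, hq, hmax⟩
        exact absurd hqY (Finset.mem_sdiff.1 (hAS hq)).2
      · exact Or.inr ⟨A, hAS.trans Finset.sdiff_subset, hAc, hA⟩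
    · rcases ih (k + 1) l Y (hsubT hYS hT) (hsubT hYS hT') (by omega) (by omega) with
        ⟨A, hAS, hAc, hA⟩ | ⟨B, hBS, hBc, hB⟩
      · exact Or.inl ⟨A, hAS.trans hYS, hAc, hA⟩
      · obtain ⟨b, hb, q, hq, hqb, hmin, hmin'⟩ := Finset.exists_first_two (A := B) (by omega)
        obtain ⟨-, A, hAS, hAc, hA, hqA, hqmax⟩ := Finset.mem_filter.1 (hBS hq)
        obtain ⟨a, ha, q', hq', haq, hmax, hmax'⟩ := Finset.exists_last_two (A := A) (by omega)
        obtain rfl : q' = q := le_antisymm (hqmax _ hq') (hmax _ hqA)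
        by_cases h : T a q' b
        · refine Or.inl ⟨insert b A, Finset.insert_subset (hYS (hBS hb)) hAS, ?_,
            hA.insert_right hT (by exact_mod_cast hAS) ha hqA haq hmax hmax' (hYS (hBS hb)) hqb h⟩
          rw [Finset.card_insert_of_notMem fun hbA => (hmax b hbA).not_gt hqb, hAc]
        · refine Or.inr ⟨insert a B, Finset.insert_subset (hAS ha) (hBS.trans hYS), ?_,
            hB.insert_left hT' (by exact_mod_cast hBS.trans hYS) hb hq hqb hmin hmin' (hAS ha)
              haq h⟩
          rw [Finset.card_insert_of_notMem fun haB => (hmin a haB).not_gt haq, hBc]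

end CupsCaps

/-- A sharpening of the cups-caps theorem by one, when the first element `0` may also be moved to
the last position `N`, as it happens to the line of smallest slope under a rotation of the plane:
`T` describes the triples of `0, …, N - 1`, and `T'` those of `1, …, N`. Right ends of
`(n - 1)`-cups for `T` together with `N` contain no `(n - 1)`-cap for `T'`, since such a cap and
such a cup could be joined; this saves one element in the recursion of Erdős and Szekeres. -/
theorem exists_cup_or_cap_of_shift (T T' : ℕ → ℕ → ℕ → Prop) (n N : ℕ) (hn : 4 ≤ n)
    (hN : N = (2 * n - 4).choose (n - 2))
    (hT : TripleTrans T (Finset.range N))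
    (hnT : TripleTrans (fun x y z => ¬ T x y z) (Finset.range N))
    (hT' : TripleTrans T' (Finset.Icc 1 N))
    (hnT' : TripleTrans (fun x y z => ¬ T' x y z) (Finset.Icc 1 N))
    (hTT' : ∀ x y z, 0 < x → x < y → y < z → z < N → (T' x y z ↔ T x y z)) :
    (∃ A ⊆ Finset.range N, A.card = n ∧ IsCup T A) ∨
    (∃ A ⊆ Finset.range N, A.card = n ∧ IsCup (fun x y z => ¬ T x y z) A) ∨
    (∃ A ⊆ Finset.Icc 1 N, A.card = n ∧ IsCup T' A) ∨
    (∃ A ⊆ Finset.Icc 1 N, A.card = n ∧ IsCup (fun x y z => ¬ T' x y z) A) := by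
  classical
  obtain ⟨k, rfl⟩ : ∃ k, n = k + 4 := ⟨n - 4, by omega⟩
  by_contra! hcon
  obtain ⟨hc1, hc2, hc3, hc4⟩ := hcon
  have hsubT : ∀ {T : ℕ → ℕ → ℕ → Prop} {S S' : Finset ℕ}, S' ⊆ S → TripleTrans T (S : Set ℕ) →
      TripleTrans T (S' : Set ℕ) := fun hs h a ha b hb c hc d hd =>
    h a (hs ha) b (hs hb) c (hs hc) d (hs hd)
  set Y := (Finset.range N).filter fun q =>
    ∃ A ⊆ Finset.range N, A.card = k + 3 ∧ IsCup T A ∧ q ∈ A ∧ ∀ x ∈ A, x ≤ q with hY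
  have hYS : Y ⊆ Finset.range N := Finset.filter_subset _ _
  have hY0 : ∀ q ∈ Y, 0 < q := by
    intro q hq
    obtain ⟨-, A, hAS, hAc, hA, hqA, hqmax⟩ := Finset.mem_filter.1 hq
    obtain ⟨a, ha, q', hq', haq, -⟩ := Finset.exists_last_two (A := A) (by omega)
    have := hqmax _ hq'
    omega
  have hsum : (Finset.range N \ Y).card + Y.card = N := by
    rw [Finset.card_sdiff_add_card_eq_card hYS, Finset.card_range]
  have hpas : N = ((k + 1) + (k + 2)).choose (k + 1) + ((k + 2) + (k + 1)).choose (k + 2) := by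
    rw [hN, show 2 * (k + 4) - 4 = (2 * k + 3) + 1 by omega, show k + 4 - 2 = (k + 1) + 1 by omega,
      Nat.choose_succ_succ, show k + 1 + (k + 2) = 2 * k + 3 by ring,
      show k + 2 + (k + 1) = 2 * k + 3 by ring]
  have h1 : (Finset.range N \ Y).card ≤ ((k + 1) + (k + 2)).choose (k + 1) := by
    by_contra! hlt
    rcases exists_cup_or_cap T (k + 1) (k + 2) _ (hsubT Finset.sdiff_subset hT)
      (hsubT Finset.sdiff_subset hnT) hlt with ⟨A, hAS, hAc, hA⟩ | ⟨A, hAS, hAc, hA⟩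
    · obtain ⟨a, ha, q, hq, haq, hmax, -⟩ := Finset.exists_last_two (A := A) (by omega)
      have hqY : q ∈ Y := Finset.mem_filter.2 ⟨Finset.sdiff_subset (hAS hq), A,
        hAS.trans Finset.sdiff_subset, hAc, hA, hq, hmax⟩
      exact absurd hqY (Finset.mem_sdiff.1 (hAS hq)).2
    · exact hc2 A (hAS.trans Finset.sdiff_subset) hAc hA
  have hNY : N ∉ Y := fun h => by simpa using hYS h
  have hNpos : 1 ≤ N := by rw [hN]; exact Nat.choose_pos (by omega)
  have hYI : insert N Y ⊆ Finset.Icc 1 N := by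
    intro q hq
    rcases Finset.mem_insert.1 hq with rfl | hq
    · exact Finset.mem_Icc.2 ⟨hNpos, le_rfl⟩
    · have := Finset.mem_range.1 (hYS hq)
      exact Finset.mem_Icc.2 ⟨hY0 q hq, this.le⟩
  have h2 : (insert N Y).card ≤ ((k + 2) + (k + 1)).choose (k + 2) := by
    by_contra! hlt
    rcases exists_cup_or_cap T' (k + 2) (k + 1) _ (hsubT hYI hT') (hsubT hYI hnT') hlt with
      ⟨A, hAS, hAc, hA⟩ | ⟨B, hBS, hBc, hB⟩
    · exact hc3 A (hAS.trans hYI) hAc hA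
    obtain ⟨b, hb, q, hq, hqb, hmin, hmin'⟩ := Finset.exists_first_two (A := B) (by omega)
    -- `B` has a third element, so `b` cannot be the last position `N`
    have hbN : b < N := by
      have hble := (Finset.mem_Icc.1 (hYI (hBS hb))).2
      refine lt_of_le_of_ne hble fun hbN => ?_
      have : B ⊆ {q, b} := by
        intro x hx
        rcases (hmin x hx).eq_or_lt with rfl | hlt
        · simp
        · have h3 := hmin' x hx hlt
          have h4 := (Finset.mem_Icc.1 (hYI (hBS hx))).2
          have : x = b := by omega
          simp [this]
      have := (Finset.card_le_card this).trans Finset.card_le_two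
      omega
    have hqY : q ∈ Y := by
      rcases Finset.mem_insert.1 (hBS hq) with rfl | h
      · omega
      · exact h
    obtain ⟨-, A, hAS, hAc, hA, hqA, hqmax⟩ := Finset.mem_filter.1 hqY
    obtain ⟨a, ha, q', hq', haq, hmax, hmax'⟩ := Finset.exists_last_two (A := A) (by omega)
    obtain rfl : q' = q := le_antisymm (hqmax _ hq') (hmax _ hqA)
    have ha0 : 0 < a := by
      by_contra! ha0
      have : A ⊆ {a, q'} := by
        intro x hx
        rcases (hmax x hx).eq_or_lt with rfl | hlt
        · simp
        · have h3 := hmax' x hx hlt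
          have : x = a := by omega
          simp [this]
      have := (Finset.card_le_card this).trans Finset.card_le_two
      omega
    by_cases h : T a q' b
    · have hbS : b ∈ Finset.range N := Finset.mem_range.2 hbN
      refine hc1 (insert b A) (Finset.insert_subset hbS hAS) ?_
        (hA.insert_right hT (by exact_mod_cast hAS) ha hqA haq hmax hmax' (by exact_mod_cast hbS)
          hqb h)
      rw [Finset.card_insert_of_notMem fun hbA => (hmax b hbA).not_gt hqb, hAc]
    · have haS : a ∈ Finset.Icc 1 N :=
        Finset.mem_Icc.2 ⟨ha0, (Finset.mem_range.1 (hAS ha)).le⟩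
      refine hc4 (insert a B) (Finset.insert_subset haS (hBS.trans hYI)) ?_
        (hB.insert_left hnT' (by exact_mod_cast hBS.trans hYI) hb hq hqb hmin hmin'
          (by exact_mod_cast haS) haq (by rwa [hTT' a q' b ha0 haq hqb hbN]))
      rw [Finset.card_insert_of_notMem fun haB => (hmin a haB).not_gt haq, hBc]
  rw [Finset.card_insert_of_notMem hNY] at h2
  omega

/-! ### Intersections of lines -/

/-- The abscissa of the intersection of two lines `y = a * x + b` of different slopes. -/
noncomputable def meet (l m : ℝ × ℝ) : ℝ := (l.2 - m.2) / (m.1 - l.1)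

theorem meet_comm (l m : ℝ × ℝ) : meet l m = meet m l := by
  rw [meet, meet, ← neg_sub m.2 l.2, ← neg_sub l.1 m.1, neg_div_neg_eq]

theorem lineVal_lt_iff_meet_lt {l m : ℝ × ℝ} (h : l.1 < m.1) {x : ℝ} :
    lineVal l x < lineVal m x ↔ meet l m < x := by
  rw [meet, div_lt_iff₀ (sub_pos.2 h), lineVal, lineVal]
  constructor <;> intro h <;> linarith

theorem lineVal_lt_iff_lt_meet {l m : ℝ × ℝ} (h : l.1 < m.1) {x : ℝ} :
    lineVal m x < lineVal l x ↔ x < meet l m := by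
  rw [meet, lt_div_iff₀ (sub_pos.2 h), lineVal, lineVal]
  constructor <;> intro h <;> linarith

theorem meet_eq_of_lineVal_eq {l m : ℝ × ℝ} (h : l.1 < m.1) {x : ℝ}
    (hx : lineVal l x = lineVal m x) : meet l m = x := by
  rw [meet, div_eq_iff (sub_pos.2 h).ne']
  simp only [lineVal] at hx
  linarith

theorem lineVal_meet {l m : ℝ × ℝ} (h : l.1 < m.1) :
    lineVal l (meet l m) = lineVal m (meet l m) := by
  have := sub_pos.2 h
  simp only [lineVal, meet]
  field_simp
  ring

section Triples

variable {x y z : ℝ × ℝ}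

/-- `meet x z` is a weighted mean of `meet x y` and `meet y z`. -/
theorem meet_mul_add (hxy : x.1 < y.1) (hyz : y.1 < z.1) :
    meet x z * ((y.1 - x.1) + (z.1 - y.1)) =
      meet x y * (y.1 - x.1) + meet y z * (z.1 - y.1) := by
  have h1 := sub_pos.2 hxy
  have h2 := sub_pos.2 hyz
  have h3 := sub_pos.2 (hxy.trans hyz)
  simp only [meet]
  rw [div_mul_cancel₀ _ h1.ne', div_mul_cancel₀ _ h2.ne', sub_add_sub_cancel',
    div_mul_cancel₀ _ h3.ne']
  ring

theorem meet_lt_meet_left_iff (hxy : x.1 < y.1) (hyz : y.1 < z.1) :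
    meet x y < meet x z ↔ meet x y < meet y z := by
  have h := meet_mul_add hxy hyz
  have h1 := sub_pos.2 hxy
  have h2 := sub_pos.2 hyz
  constructor <;> intro h3 <;> by_contra! h4 <;> nlinarith

theorem meet_lt_meet_right_iff (hxy : x.1 < y.1) (hyz : y.1 < z.1) :
    meet x z < meet y z ↔ meet x y < meet y z := by
  have h := meet_mul_add hxy hyz
  have h1 := sub_pos.2 hxy
  have h2 := sub_pos.2 hyz
  constructor <;> intro h3 <;> by_contra! h4 <;> nlinarith

theorem meet_gt_meet_left_iff (hxy : x.1 < y.1) (hyz : y.1 < z.1) :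
    meet x z < meet x y ↔ meet y z < meet x y := by
  have h := meet_mul_add hxy hyz
  have h1 := sub_pos.2 hxy
  have h2 := sub_pos.2 hyz
  constructor <;> intro h3 <;> by_contra! h4 <;> nlinarith

theorem meet_gt_meet_right_iff (hxy : x.1 < y.1) (hyz : y.1 < z.1) :
    meet y z < meet x z ↔ meet y z < meet x y := by
  have h := meet_mul_add hxy hyz
  have h1 := sub_pos.2 hxy
  have h2 := sub_pos.2 hyz
  constructor <;> intro h3 <;> by_contra! h4 <;> nlinarith

end Triples

/-- On the line `l`, the prescribed side of the line `m` lies to the right of the intersection. -/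
def IsLowerBound (U : Set (ℝ × ℝ)) (l m : ℝ × ℝ) : Prop :=
  (m.1 < l.1 ∧ m ∉ U) ∨ (l.1 < m.1 ∧ m ∈ U)

/-- On the line `l`, the prescribed side of the line `m` lies to the left of the intersection. -/
def IsUpperBound (U : Set (ℝ × ℝ)) (l m : ℝ × ℝ) : Prop :=
  (m.1 < l.1 ∧ m ∈ U) ∨ (l.1 < m.1 ∧ m ∉ U)

theorem lineSide_iff {U : Set (ℝ × ℝ)} {l m : ℝ × ℝ} (h : m.1 ≠ l.1) {x : ℝ} :
    lineSide U m (x, lineVal l x) ↔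
      (IsLowerBound U l m → meet l m < x) ∧ (IsUpperBound U l m → x < meet l m) := by
  unfold lineSide IsLowerBound IsUpperBound
  rcases lt_or_gt_of_ne h with h | h
  · rw [meet_comm l m, ← lineVal_lt_iff_meet_lt h, ← lineVal_lt_iff_lt_meet h]
    simp only [h, h.not_gt, true_and, false_and, or_false]
    tauto
  · rw [← lineVal_lt_iff_meet_lt h, ← lineVal_lt_iff_lt_meet h]
    simp only [h, h.not_gt, true_and, false_and, false_or]

/-- A family of lines bounds a cell as soon as, on each line, the other lines leave a nonempty
interval. -/
theorem boundsCell_iff {S : Finset (ℝ × ℝ)} {U : Set (ℝ × ℝ)}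
    (hS : Set.InjOn Prod.fst (S : Set (ℝ × ℝ))) :
    BoundsCell S U ↔ ∀ l ∈ S, ∀ m ∈ S, ∀ m' ∈ S, IsLowerBound U l m → IsUpperBound U l m' →
      meet l m < meet l m' := by
  classical
  have hne : ∀ l ∈ S, ∀ m ∈ S, m ≠ l → m.1 ≠ l.1 := fun l hl m hm h h' =>
    h (hS (by exact_mod_cast hm) (by exact_mod_cast hl) h')
  have hlo : ∀ {l m}, IsLowerBound U l m → m ≠ l := by
    rintro l m h rfl
    simp [IsLowerBound] at h
  have hhi : ∀ {l m}, IsUpperBound U l m → m ≠ l := by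
    rintro l m h rfl
    simp [IsUpperBound] at h
  constructor
  · intro h l hl m hm m' hm' hb hb'
    obtain ⟨x, hx⟩ := h l hl
    have h1 := ((lineSide_iff (hne l hl m hm (hlo hb))).1 (hx m hm (hlo hb))).1 hb
    have h2 := ((lineSide_iff (hne l hl m' hm' (hhi hb'))).1 (hx m' hm' (hhi hb'))).2 hb'
    exact h1.trans h2
  · intro h l hl
    obtain ⟨x, hx1, hx2⟩ := Order.exists_between_finsets
      ((S.filter (IsLowerBound U l)).image (meet l)) ((S.filter (IsUpperBound U l)).image (meet l))
      (by
        intro a ha b hb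
        obtain ⟨m, hm, rfl⟩ := Finset.mem_image.1 ha
        obtain ⟨m', hm', rfl⟩ := Finset.mem_image.1 hb
        rw [Finset.mem_filter] at hm hm'
        exact h l hl m hm.1 m' hm'.1 hm.2 hm'.2)
    refine ⟨x, fun m hm hml => (lineSide_iff (hne l hl m hm hml)).2 ⟨fun hb => ?_, fun hb => ?_⟩⟩
    · exact hx1 _ (Finset.mem_image_of_mem _ (Finset.mem_filter.2 ⟨hm, hb⟩))
    · exact hx2 _ (Finset.mem_image_of_mem _ (Finset.mem_filter.2 ⟨hm, hb⟩))

/-! ### Cups and caps of lines bound cells -/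

section Cells

variable {S : Finset (ℝ × ℝ)}

theorem boundsCell_of_cup (hS : Set.InjOn Prod.fst (S : Set (ℝ × ℝ)))
    (h : ∀ x ∈ S, ∀ y ∈ S, ∀ z ∈ S, x.1 < y.1 → y.1 < z.1 → meet x y < meet y z) :
    BoundsCell S ∅ := by
  rw [boundsCell_iff hS]
  intro y hy x hx z hz hb hb'
  simp only [IsLowerBound, IsUpperBound, Set.mem_empty_iff_false, not_false_eq_true, and_true,
    and_false, or_false, false_or] at hb hb'
  rw [meet_comm y x]
  exact h x hx y hy z hz hb hb'

theorem boundsCell_of_cap (hS : Set.InjOn Prod.fst (S : Set (ℝ × ℝ)))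
    (h : ∀ x ∈ S, ∀ y ∈ S, ∀ z ∈ S, x.1 < y.1 → y.1 < z.1 → meet y z < meet x y) :
    BoundsCell S Set.univ := by
  rw [boundsCell_iff hS]
  intro y hy z hz x hx hb hb'
  simp only [IsLowerBound, IsUpperBound, Set.mem_univ, not_true, and_true,
    and_false, or_false, false_or] at hb hb'
  rw [meet_comm y x]
  exact h x hx y hy z hz hb' hb

variable {p : ℝ × ℝ}

/-- A cup below a line `p` of smaller slope that passes above all its vertices. -/
theorem boundsCell_insert_of_cup [DecidableEq (ℝ × ℝ)]
    (hS : Set.InjOn Prod.fst (S : Set (ℝ × ℝ))) (hp : ∀ x ∈ S, p.1 < x.1)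
    (h : ∀ x ∈ S, ∀ y ∈ S, ∀ z ∈ S, x.1 < y.1 → y.1 < z.1 → meet x y < meet y z)
    (h' : ∀ x ∈ S, ∀ y ∈ S, x.1 < y.1 → meet x y < meet p x) :
    BoundsCell (insert p S) {p} := by
  have hpS : ∀ x ∈ S, x ≠ p := fun x hx e => (hp x hx).ne (by rw [e])
  have hI : Set.InjOn Prod.fst ((insert p S : Finset (ℝ × ℝ)) : Set (ℝ × ℝ)) := by
    rw [Finset.coe_insert, Set.injOn_insert (fun hm => (hpS p hm) rfl)]
    exact ⟨hS, fun ⟨x, hx, e⟩ => (hp x hx).ne e.symm⟩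
  rw [boundsCell_iff hI]
  intro y hy x hx z hz hb hb'
  simp only [IsLowerBound, IsUpperBound, Set.mem_singleton_iff] at hb hb'
  rcases Finset.mem_insert.1 hy with rfl | hyS
  · -- on `p` all bounds are upper bounds
    rcases hb with ⟨hlt, hne⟩ | ⟨hlt, rfl⟩
    · exact absurd hlt (hp x (Finset.mem_of_mem_insert_of_ne hx hne)).not_gt
    · exact absurd hlt (lt_irrefl _)
  rcases hb with ⟨hxy, hne⟩ | ⟨hlt, rfl⟩
  · have hxS := Finset.mem_of_mem_insert_of_ne hx hne
    rw [meet_comm y x]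
    rcases hb' with ⟨hlt, rfl⟩ | ⟨hyz, hne'⟩
    · rw [meet_comm y z]
      exact (meet_gt_meet_right_iff (hp x hxS) hxy).2 (h' x hxS y hyS hxy)
    · exact h x hxS y hyS z (Finset.mem_of_mem_insert_of_ne hz hne') hxy hyz
  · exact absurd hlt (hp y hyS).not_gt

/-- A cap above a line `p` of smaller slope that passes below all its vertices. -/
theorem boundsCell_insert_of_cap [DecidableEq (ℝ × ℝ)]
    (hS : Set.InjOn Prod.fst (S : Set (ℝ × ℝ))) (hp : ∀ x ∈ S, p.1 < x.1)
    (h : ∀ x ∈ S, ∀ y ∈ S, ∀ z ∈ S, x.1 < y.1 → y.1 < z.1 → meet y z < meet x y)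
    (h' : ∀ x ∈ S, ∀ y ∈ S, x.1 < y.1 → meet p x < meet x y) :
    BoundsCell (insert p S) {p}ᶜ := by
  have hpS : ∀ x ∈ S, x ≠ p := fun x hx e => (hp x hx).ne (by rw [e])
  have hI : Set.InjOn Prod.fst ((insert p S : Finset (ℝ × ℝ)) : Set (ℝ × ℝ)) := by
    rw [Finset.coe_insert, Set.injOn_insert (fun hm => (hpS p hm) rfl)]
    exact ⟨hS, fun ⟨x, hx, e⟩ => (hp x hx).ne e.symm⟩
  rw [boundsCell_iff hI]
  intro y hy z hz x hx hb' hb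
  simp only [IsLowerBound, IsUpperBound, Set.mem_compl_iff, Set.mem_singleton_iff, not_not]
    at hb hb'
  rcases Finset.mem_insert.1 hy with rfl | hyS
  · -- on `p` all bounds are lower bounds
    rcases hb with ⟨hlt, hne⟩ | ⟨hlt, rfl⟩
    · exact absurd hlt (hp x (Finset.mem_of_mem_insert_of_ne hx hne)).not_gt
    · exact absurd hlt (lt_irrefl _)
  rcases hb with ⟨hxy, hne⟩ | ⟨hlt, rfl⟩
  · have hxS := Finset.mem_of_mem_insert_of_ne hx hne
    rw [meet_comm y x]
    rcases hb' with ⟨hlt, rfl⟩ | ⟨hyz, hne'⟩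
    · rw [meet_comm y z]
      exact (meet_lt_meet_right_iff (hp x hxS) hxy).2 (h' x hxS y hyS hxy)
    · exact h x hxS y hyS z (Finset.mem_of_mem_insert_of_ne hz hne') hxy hyz
  · exact absurd hlt (hp y hyS).not_gt

end Cells

/-! ### The upper bound -/

section UpperBound

variable {e : ℕ → ℝ × ℝ} {N : ℕ}

/-- The lines `e i`, `e j`, `e k` form a cup: the middle line is on the upper envelope. -/
def LineCup (e : ℕ → ℝ × ℝ) (i j k : ℕ) : Prop := meet (e i) (e j) < meet (e j) (e k)

/-- The cup relation after a rotation of the plane that makes the line of smallest slope `e 0` the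
line of largest slope; in its new position it carries the index `N`. -/
def ShiftedLineCup (e : ℕ → ℝ × ℝ) (N i j k : ℕ) : Prop :=
  if k = N then ¬ LineCup e 0 i j else LineCup e i j k

theorem tripleTrans_lineCup (he : ∀ i j, i < j → j < N → (e i).1 < (e j).1) :
    TripleTrans (LineCup e) (Finset.range N) := by
  intro a _ b hb c hc d hd hab hbc hcd h1 h2
  simp only [Finset.coe_range, Set.mem_Iio] at hb hc hd
  have eab := he a b hab hb
  have ebc := he b c hbc hc
  have ecd := he c d hcd hd
  simp only [LineCup] at *
  exact ⟨h1.trans ((meet_lt_meet_left_iff ebc ecd).2 h2),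
    ((meet_lt_meet_right_iff eab ebc).2 h1).trans h2⟩

theorem tripleTrans_not_lineCup (he : ∀ i j, i < j → j < N → (e i).1 < (e j).1) :
    TripleTrans (fun i j k => ¬ LineCup e i j k) (Finset.range N) := by
  intro a _ b hb c hc d hd hab hbc hcd h1 h2
  simp only [Finset.coe_range, Set.mem_Iio] at hb hc hd
  have eab := he a b hab hb
  have ebc := he b c hbc hc
  have ecd := he c d hcd hd
  simp only [LineCup] at *
  have h3 := (meet_lt_meet_left_iff ebc ecd).not.2 h2
  have h4 := (meet_lt_meet_right_iff eab ebc).not.2 h1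
  rw [not_lt] at h1 h2 h3 h4
  exact ⟨not_lt.2 (h3.trans h1), not_lt.2 (h2.trans h4)⟩

theorem tripleTrans_shiftedLineCup (he : ∀ i j, i < j → j < N → (e i).1 < (e j).1) :
    TripleTrans (ShiftedLineCup e N) (Finset.Icc 1 N) := by
  intro a ha b hb c hc d hd hab hbc hcd h1 h2
  simp only [Finset.coe_Icc, Set.mem_Icc] at ha hb hc hd
  rcases eq_or_ne d N with rfl | hdN
  · have e0a := he 0 a ha.1 (by omega)
    have eab := he a b hab (by omega)
    have ebc := he b c hbc (by omega)
    simp only [ShiftedLineCup, LineCup, hcd.ne, if_true, if_false, not_lt] at *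
    have h3 := (meet_gt_meet_right_iff e0a eab).1 (h1.trans_le h2)
    have h4 := (meet_gt_meet_left_iff e0a eab).2 h3
    have h5 := (meet_lt_meet_right_iff eab ebc).2 h1
    exact ⟨h3.le, (h5.trans_le (h2.trans h4.le)).le⟩
  · have hcN : c ≠ N := by omega
    simp only [ShiftedLineCup, hdN, hcN, if_false] at *
    exact tripleTrans_lineCup he a (by simp; omega) b (by simp; omega) c (by simp; omega) d
      (by simp; omega) hab hbc hcd h1 h2

theorem tripleTrans_not_shiftedLineCup (he : ∀ i j, i < j → j < N → (e i).1 < (e j).1) :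
    TripleTrans (fun i j k => ¬ ShiftedLineCup e N i j k) (Finset.Icc 1 N) := by
  intro a ha b hb c hc d hd hab hbc hcd h1 h2
  simp only [Finset.coe_Icc, Set.mem_Icc] at ha hb hc hd
  rcases eq_or_ne d N with rfl | hdN
  · have e0a := he 0 a ha.1 (by omega)
    have eab := he a b hab (by omega)
    have ebc := he b c hbc (by omega)
    simp only [ShiftedLineCup, LineCup, hcd.ne, if_true, if_false, not_lt, not_le] at *
    have h3 := (meet_lt_meet_right_iff e0a eab).1 (h2.trans_le h1)
    have h4 := (meet_lt_meet_left_iff e0a eab).2 h3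
    have h5 := (meet_lt_meet_right_iff eab ebc).not.2 h1.not_gt
    rw [not_lt] at h5
    exact ⟨h3, (h4.trans h2).trans_le h5⟩
  · have hcN : c ≠ N := by omega
    simp only [ShiftedLineCup, hdN, hcN, if_false] at *
    exact tripleTrans_not_lineCup he a (by simp; omega) b (by simp; omega) c (by simp; omega) d
      (by simp; omega) hab hbc hcd h1 h2

/-- No three of the lines `e 0, …, e (N - 1)`, listed by increasing slope, are concurrent. -/
def NoTripleMeet (e : ℕ → ℝ × ℝ) (N : ℕ) : Prop :=
  ∀ i j k, i < j → j < k → k < N → meet (e i) (e j) ≠ meet (e j) (e k)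

theorem fst_lt_iff (he : ∀ i j, i < j → j < N → (e i).1 < (e j).1) {i j : ℕ} (hi : i < N)
    (hj : j < N) : (e i).1 < (e j).1 ↔ i < j := by
  refine ⟨fun h => ?_, fun h => he i j h hj⟩
  by_contra! hle
  rcases hle.eq_or_lt with rfl | hlt
  · exact lt_irrefl _ h
  · exact h.not_gt (he j i hlt hi)

theorem injOn_fst_image (he : ∀ i j, i < j → j < N → (e i).1 < (e j).1) [DecidableEq (ℝ × ℝ)]
    {A : Finset ℕ} (hA : A ⊆ Finset.range N) :
    Set.InjOn e (A : Set ℕ) ∧ Set.InjOn Prod.fst ((A.image e : Finset (ℝ × ℝ)) : Set (ℝ × ℝ)) := by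
  have key : ∀ i ∈ A, ∀ j ∈ A, (e i).1 = (e j).1 → i = j := fun i hi j hj h => by
    rcases lt_trichotomy i j with hlt | h' | hlt
    · exact absurd h (he i j hlt (Finset.mem_range.1 (hA hj))).ne
    · exact h'
    · exact absurd h (he j i hlt (Finset.mem_range.1 (hA hi))).ne'
  refine ⟨fun i hi j hj h => key i hi j hj (by rw [h]), ?_⟩
  rintro l hl m hm h
  obtain ⟨i, hi, rfl⟩ := Finset.mem_image.1 (Finset.mem_coe.1 hl)
  obtain ⟨j, hj, rfl⟩ := Finset.mem_image.1 (Finset.mem_coe.1 hm)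
  rw [key i hi j hj h]

theorem IsCup.image_lines (he : ∀ i j, i < j → j < N → (e i).1 < (e j).1) [DecidableEq (ℝ × ℝ)]
    {A : Finset ℕ} (hA : A ⊆ Finset.range N) (h : IsCup (LineCup e) A) :
    ∀ x ∈ A.image e, ∀ y ∈ A.image e, ∀ z ∈ A.image e, x.1 < y.1 → y.1 < z.1 →
      meet x y < meet y z := by
  intro x hx y hy z hz hxy hyz
  obtain ⟨i, hi, rfl⟩ := Finset.mem_image.1 hx
  obtain ⟨j, hj, rfl⟩ := Finset.mem_image.1 hy
  obtain ⟨k, hk, rfl⟩ := Finset.mem_image.1 hz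
  have hr : ∀ {m}, m ∈ A → m < N := fun hm => Finset.mem_range.1 (hA hm)
  exact h i hi j hj k hk ((fst_lt_iff he (hr hi) (hr hj)).1 hxy)
    ((fst_lt_iff he (hr hj) (hr hk)).1 hyz)

theorem IsCup.image_lines_of_not (he : ∀ i j, i < j → j < N → (e i).1 < (e j).1)
    (hc : NoTripleMeet e N) [DecidableEq (ℝ × ℝ)] {A : Finset ℕ} (hA : A ⊆ Finset.range N)
    (h : IsCup (fun i j k => ¬ LineCup e i j k) A) :
    ∀ x ∈ A.image e, ∀ y ∈ A.image e, ∀ z ∈ A.image e, x.1 < y.1 → y.1 < z.1 →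
      meet y z < meet x y := by
  intro x hx y hy z hz hxy hyz
  obtain ⟨i, hi, rfl⟩ := Finset.mem_image.1 hx
  obtain ⟨j, hj, rfl⟩ := Finset.mem_image.1 hy
  obtain ⟨k, hk, rfl⟩ := Finset.mem_image.1 hz
  have hr : ∀ {m}, m ∈ A → m < N := fun hm => Finset.mem_range.1 (hA hm)
  have hij := (fst_lt_iff he (hr hi) (hr hj)).1 hxy
  have hjk := (fst_lt_iff he (hr hj) (hr hk)).1 hyz
  exact lt_of_le_of_ne (not_lt.1 (h i hi j hj k hk hij hjk)) (hc i j k hij hjk (hr hk)).symm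

/-- A cup or a cap of lines is in convex position. -/
theorem exists_boundsCell_of_cup_or_cap (he : ∀ i j, i < j → j < N → (e i).1 < (e j).1)
    (hc : NoTripleMeet e N) [DecidableEq (ℝ × ℝ)] {A : Finset ℕ} (hA : A ⊆ Finset.range N)
    (h : IsCup (LineCup e) A ∨ IsCup (fun i j k => ¬ LineCup e i j k) A) :
    ∃ S ⊆ (Finset.range N).image e, S.card = A.card ∧ ∃ U, BoundsCell S U := by
  obtain ⟨hinj, hinj'⟩ := injOn_fst_image he hA
  refine ⟨A.image e, Finset.image_subset_image hA, Finset.card_image_of_injOn hinj, ?_⟩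
  rcases h with h | h
  · exact ⟨_, boundsCell_of_cup hinj' (h.image_lines he hA)⟩
  · exact ⟨_, boundsCell_of_cap hinj' (h.image_lines_of_not he hc hA)⟩

/-- A cup or a cap after the rotation that moves the first line to the end. -/
theorem exists_boundsCell_of_shifted (he : ∀ i j, i < j → j < N → (e i).1 < (e j).1)
    (hc : NoTripleMeet e N) [DecidableEq (ℝ × ℝ)] {A : Finset ℕ} (hA : A ⊆ Finset.Icc 1 N)
    (h : IsCup (ShiftedLineCup e N) A ∨ IsCup (fun i j k => ¬ ShiftedLineCup e N i j k) A) :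
    ∃ S ⊆ (Finset.range N).image e, S.card = A.card ∧ ∃ U, BoundsCell S U := by
  set B := A.erase N with hB
  have hBI : ∀ i ∈ B, 0 < i ∧ i < N := fun i hi => by
    have h1 := Finset.mem_erase.1 hi
    have h2 := Finset.mem_Icc.1 (hA h1.2)
    exact ⟨h2.1, lt_of_le_of_ne h2.2 h1.1⟩
  have hBr : B ⊆ Finset.range N := fun i hi => Finset.mem_range.2 (hBI i hi).2
  have hBA : B ⊆ A := Finset.erase_subset _ _
  have hcupB : IsCup (LineCup e) B ∨ IsCup (fun i j k => ¬ LineCup e i j k) B := by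
    refine h.imp (fun h i hi j hj k hk hij hjk => ?_) (fun h i hi j hj k hk hij hjk => ?_)
    · simpa [ShiftedLineCup, (hBI k hk).2.ne] using h i (hBA hi) j (hBA hj) k (hBA hk) hij hjk
    · simpa [ShiftedLineCup, (hBI k hk).2.ne] using h i (hBA hi) j (hBA hj) k (hBA hk) hij hjk
  by_cases hNA : N ∈ A
  swap
  · rw [hB, Finset.erase_eq_of_notMem hNA] at hcupB hBr
    exact exists_boundsCell_of_cup_or_cap he hc hBr hcupB
  obtain ⟨hinj, hinj'⟩ := injOn_fst_image he hBr
  have hr : ∀ {m}, m ∈ B → m < N := fun hm => (hBI _ hm).2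
  have h0 : ∀ x ∈ B.image e, (e 0).1 < x.1 := fun x hx => by
    obtain ⟨i, hi, rfl⟩ := Finset.mem_image.1 hx
    exact he 0 i (hBI i hi).1 (hr hi)
  have hN0 : 0 < N := (Finset.mem_Icc.1 (hA hNA)).1
  refine ⟨insert (e 0) (B.image e), ?_, ?_, ?_⟩
  · exact Finset.insert_subset (Finset.mem_image_of_mem _ (Finset.mem_range.2 hN0))
      (Finset.image_subset_image hBr)
  · rw [Finset.card_insert_of_notMem fun hm => lt_irrefl _ (h0 _ hm),
      Finset.card_image_of_injOn hinj, hB, Finset.card_erase_add_one hNA]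
  rcases h with h | h
  · refine ⟨_, boundsCell_insert_of_cup hinj' h0
      (IsCup.image_lines he hBr ?_) fun x hx y hy hxy => ?_⟩
    · intro i hi j hj k hk hij hjk
      simpa [ShiftedLineCup, (hr hk).ne] using h i (hBA hi) j (hBA hj) k (hBA hk) hij hjk
    · obtain ⟨i, hi, rfl⟩ := Finset.mem_image.1 hx
      obtain ⟨j, hj, rfl⟩ := Finset.mem_image.1 hy
      have hij := (fst_lt_iff he (hr hi) (hr hj)).1 hxy
      have := h i (hBA hi) j (hBA hj) N hNA hij (hr hj)
      simp only [ShiftedLineCup, if_true, LineCup, not_lt] at this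
      exact lt_of_le_of_ne this (hc 0 i j (hBI i hi).1 hij (hr hj)).symm
  · refine ⟨_, boundsCell_insert_of_cap hinj' h0
      (IsCup.image_lines_of_not he hc hBr ?_) fun x hx y hy hxy => ?_⟩
    · intro i hi j hj k hk hij hjk
      simpa [ShiftedLineCup, (hr hk).ne] using h i (hBA hi) j (hBA hj) k (hBA hk) hij hjk
    · obtain ⟨i, hi, rfl⟩ := Finset.mem_image.1 hx
      obtain ⟨j, hj, rfl⟩ := Finset.mem_image.1 hy
      have hij := (fst_lt_iff he (hr hi) (hr hj)).1 hxy
      have := h i (hBA hi) j (hBA hj) N hNA hij (hr hj)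
      simpa only [ShiftedLineCup, if_true, LineCup, not_not] using this

end UpperBound

/-- A family of `N` lines in general position can be listed by increasing slope. -/
theorem GeneralPosition.exists_enum {F : Finset (AffineSubspace ℝ (ℝ × ℝ))}
    [DecidableEq (AffineSubspace ℝ (ℝ × ℝ))] [DecidableEq (ℝ × ℝ)]
    (hF : GeneralPosition F) {N : ℕ} (hN : N ≤ F.card) :
    ∃ e : ℕ → ℝ × ℝ, (∀ i j, i < j → j < N → (e i).1 < (e j).1) ∧ NoTripleMeet e N ∧
      ∀ i < N, graphLine (e i) ∈ F := by
  obtain ⟨F', hF', hcard⟩ := Finset.exists_subset_card_eq hN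
  have hex : ∀ l : AffineSubspace ℝ (ℝ × ℝ), ∃ m, l ∈ F → graphLine m = l := fun l => by
    by_cases hl : l ∈ F
    · obtain ⟨m, hm⟩ := exists_eq_graphLine (hF.isLine l hl) (hF.not_vertical l hl)
      exact ⟨m, fun _ => hm⟩
    · exact ⟨0, fun h => absurd h hl⟩
  choose g hg using hex
  have hslope : Set.InjOn (fun l => (g l).1) (F' : Set (AffineSubspace ℝ (ℝ × ℝ))) := by
    intro l hl m hm h
    by_contra hne
    have hlF := hF' (Finset.mem_coe.1 hl)
    have hmF := hF' (Finset.mem_coe.1 hm)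
    apply hF.not_parallel l hlF m hmF hne
    rw [← hg l hlF, ← hg m hmF]
    exact graphLine_parallel_iff.2 h
  have hQ : (F'.image fun l => (g l).1).card = N := by
    rw [Finset.card_image_of_injOn hslope, hcard]
  set o := (F'.image fun l => (g l).1).orderEmbOfFin hQ
  have ho : ∀ i, ∃ l ∈ F', (g l).1 = o i := fun i =>
    Finset.mem_image.1 (Finset.orderEmbOfFin_mem _ hQ i)
  choose f hf hfo using ho
  set e : ℕ → ℝ × ℝ := fun i => if h : i < N then g (f ⟨i, h⟩) else 0 with he
  have hei : ∀ i (h : i < N), e i = g (f ⟨i, h⟩) := fun i h => by simp [he, h]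
  have hmem : ∀ i < N, graphLine (e i) ∈ F := fun i h => by
    rw [hei i h, hg _ (hF' (hf _))]
    exact hF' (hf _)
  have hmono : ∀ i j, i < j → j < N → (e i).1 < (e j).1 := fun i j hij hj => by
    rw [hei i (hij.trans hj), hei j hj, hfo, hfo]
    exact o.strictMono hij
  refine ⟨e, hmono, fun i j k hij hjk hk h => ?_, hmem⟩
  have hne : ∀ i j, i < j → j < N → graphLine (e i) ≠ graphLine (e j) := fun i j hij hj h =>
    (hmono i j hij hj).ne (by rw [graphLine_injective h])
  have hj := hjk.trans hk
  refine hF.not_concurrent _ (hmem i (hij.trans hj)) _ (hmem j hj) _ (hmem k hk)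
    (hne i j hij hj) (hne i k (hij.trans hjk) hk) (hne j k hjk hk)
    ⟨(meet (e i) (e j), lineVal (e j) (meet (e i) (e j))), ?_, ?_, ?_⟩
  · exact mem_graphLine.2 (lineVal_meet (hmono i j hij hj)).symm
  · exact mem_graphLine.2 rfl
  · rw [h]
    exact mem_graphLine.2 (lineVal_meet (hmono j k hjk hk))

theorem spansCell_of_boundsCell {F : Finset (AffineSubspace ℝ (ℝ × ℝ))}
    [DecidableEq (AffineSubspace ℝ (ℝ × ℝ))] {n : ℕ} (hn : 0 < n)
    {S : Finset (ℝ × ℝ)} (hSF : ∀ l ∈ S, graphLine l ∈ F) (hS : S.card = n)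
    {U : Set (ℝ × ℝ)} (h : BoundsCell S U) : SpansCell F n := by
  refine ⟨S.image graphLine, ?_, ?_, h.inConvexPosition (Finset.card_pos.1 (by omega))⟩
  · intro l hl
    obtain ⟨m, hm, rfl⟩ := Finset.mem_image.1 hl
    exact hSF m hm
  · rw [Finset.card_image_of_injective _ graphLine_injective, hS]

theorem three_mem_sufficientSizes : 3 ∈ sufficientSizes 3 := by
  classical
  intro F hF hN
  obtain ⟨e, he, hc, heF⟩ := hF.exists_enum hN
  have : ∃ A ⊆ Finset.range 3, A.card = 3 ∧
      (IsCup (LineCup e) A ∨ IsCup (fun i j k => ¬ LineCup e i j k) A) := by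
    rcases exists_cup_or_cap (LineCup e) 1 1 (Finset.range 3) (tripleTrans_lineCup he)
      (tripleTrans_not_lineCup he) (by decide) with ⟨A, h1, h2, h3⟩ | ⟨A, h1, h2, h3⟩
    · exact ⟨A, h1, h2, Or.inl h3⟩
    · exact ⟨A, h1, h2, Or.inr h3⟩
  obtain ⟨A, hA, hAc, h⟩ := this
  obtain ⟨S, hS, hSc, U, hU⟩ := exists_boundsCell_of_cup_or_cap he hc hA h
  refine spansCell_of_boundsCell (by omega) (fun l hl => ?_) (hSc.trans hAc) hU
  obtain ⟨i, hi, rfl⟩ := Finset.mem_image.1 (hS hl)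
  exact heF i (Finset.mem_range.1 hi)

theorem choose_mem_sufficientSizes {n : ℕ} (hn : 4 ≤ n) :
    (2 * n - 4).choose (n - 2) ∈ sufficientSizes n := by
  classical
  intro F hF hN
  obtain ⟨e, he, hc, heF⟩ := hF.exists_enum hN
  set N := (2 * n - 4).choose (n - 2) with hNdef
  have : ∃ S ⊆ (Finset.range N).image e, S.card = n ∧ ∃ U, BoundsCell S U := by
    rcases exists_cup_or_cap_of_shift (LineCup e) (ShiftedLineCup e N) n N hn hNdef
      (tripleTrans_lineCup he) (tripleTrans_not_lineCup he) (tripleTrans_shiftedLineCup he)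
      (tripleTrans_not_shiftedLineCup he)
      (fun x y z _ _ _ hz => by simp [ShiftedLineCup, hz.ne]) with
      ⟨A, h1, rfl, h3⟩ | ⟨A, h1, rfl, h3⟩ | ⟨A, h1, rfl, h3⟩ | ⟨A, h1, rfl, h3⟩
    · exact exists_boundsCell_of_cup_or_cap he hc h1 (Or.inl h3)
    · exact exists_boundsCell_of_cup_or_cap he hc h1 (Or.inr h3)
    · exact exists_boundsCell_of_shifted he hc h1 (Or.inl h3)
    · exact exists_boundsCell_of_shifted he hc h1 (Or.inr h3)
  obtain ⟨S, hS, hSc, U, hU⟩ := this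
  refine spansCell_of_boundsCell (by omega) (fun l hl => ?_) hSc hU
  obtain ⟨i, hi, rfl⟩ := Finset.mem_image.1 (hS hl)
  exact heF i (Finset.mem_range.1 hi)

/-! ### Binary words and their branching levels -/

section Words

variable {N : ℕ}

/-- Finite sets of levels are read as binary words, the largest level being the leading digit.
`BranchAt i x y` says that `i` is the leading level at which `x` and `y` differ, and that `x` is the
smaller of the two words. -/
def BranchAt (i : Fin N) (x y : Finset (Fin N)) : Prop :=
  i ∉ x ∧ i ∈ y ∧ ∀ j, i < j → (j ∈ x ↔ j ∈ y)

variable {i j : Fin N} {x y z : Finset (Fin N)}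

theorem BranchAt.ne (h : BranchAt i x y) : x ≠ y := by
  rintro rfl
  exact h.1 h.2.1

theorem exists_branchAt (h : x ≠ y) : (∃ i, BranchAt i x y) ∨ ∃ i, BranchAt i y x := by
  have hne : (symmDiff x y).Nonempty := by
    rw [Finset.nonempty_iff_ne_empty]
    exact fun h' => h (symmDiff_eq_bot.1 h')
  set i := (symmDiff x y).max' hne
  have hi : i ∈ symmDiff x y := Finset.max'_mem _ _
  have hgt : ∀ j, i < j → (j ∈ x ↔ j ∈ y) := fun j hj => by
    have : j ∉ symmDiff x y := fun hm => (Finset.le_max' _ _ hm).not_gt hj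
    rw [Finset.mem_symmDiff] at this
    tauto
  rcases Finset.mem_symmDiff.1 hi with ⟨h1, h2⟩ | ⟨h1, h2⟩
  · exact Or.inr ⟨i, h2, h1, fun j hj => (hgt j hj).symm⟩
  · exact Or.inl ⟨i, h2, h1, hgt⟩

theorem BranchAt.level_unique (h : BranchAt i x y) (h' : BranchAt j x y) : i = j := by
  rcases lt_trichotomy i j with hlt | rfl | hlt
  · exact absurd ((h.2.2 j hlt).2 h'.2.1) h'.1
  · rfl
  · exact absurd ((h'.2.2 i hlt).2 h.2.1) h.1

theorem BranchAt.trans (h : BranchAt i x y) (h' : BranchAt j y z) :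
    ((i : ℕ) < j ∧ BranchAt j x z) ∨ ((j : ℕ) < i ∧ BranchAt i x z) := by
  rcases lt_trichotomy i j with hlt | rfl | hlt
  · exact Or.inl ⟨hlt, fun hx => h'.1 ((h.2.2 j hlt).1 hx), h'.2.1,
      fun k hk => (h.2.2 k (hlt.trans hk)).trans (h'.2.2 k hk)⟩
  · exact absurd h.2.1 h'.1
  · exact Or.inr ⟨hlt, h.1, (h'.2.2 i hlt).1 h.2.1,
      fun k hk => (h.2.2 k hk).trans (h'.2.2 k (hlt.trans hk))⟩

theorem BranchAt.level_ne (h : BranchAt i x y) (h' : BranchAt j y z) : i ≠ j := by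
  rintro rfl
  exact h'.1 h.2.1

theorem branchAt_compl : BranchAt i xᶜ yᶜ ↔ BranchAt i y x := by
  simp only [BranchAt, Finset.mem_compl, not_not, not_iff_not]
  constructor <;> rintro ⟨h1, h2, h3⟩ <;> exact ⟨h2, h1, fun j hj => (h3 j hj).symm⟩

theorem exists_branchAt_of_one_lt_card {s : Finset (Finset (Fin N))} (h : 1 < s.card) :
    ∃ a ∈ s, ∃ b ∈ s, ∃ i, BranchAt i a b := by
  obtain ⟨a, ha, b, hb, hab⟩ := Finset.one_lt_card.1 h
  rcases exists_branchAt hab with ⟨i, hi⟩ | ⟨i, hi⟩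
  · exact ⟨a, ha, b, hb, i, hi⟩
  · exact ⟨b, hb, a, ha, i, hi⟩

/-- The difference of the sums of `g` over two words is dominated by the branching level. -/
theorem BranchAt.abs_sum_sub_sum_sub_le (h : BranchAt i x y) (g : Fin N → ℝ) :
    |∑ j ∈ y, g j - ∑ j ∈ x, g j - g i| ≤ ∑ j ∈ Finset.univ.filter (· < i), |g j| := by
  have e : ∑ j ∈ y, g j - ∑ j ∈ x, g j - g i =
      ∑ j, ((if j ∈ y then g j else 0) - (if j ∈ x then g j else 0) -
        (if j = i then g j else 0)) := by
    simp [Finset.sum_sub_distrib]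
  rw [e, Finset.sum_filter]
  refine (Finset.abs_sum_le_sum_abs _ _).trans (Finset.sum_le_sum fun j _ => ?_)
  rcases lt_trichotomy j i with hlt | rfl | hlt
  · simp only [hlt, hlt.ne, if_true, if_false, sub_zero]
    split_ifs <;> simp
  · simp [h.1, h.2.1]
  · simp [h.2.2 j hlt, hlt.ne', hlt.not_gt]

/-! ### The lines of binary words -/

/-- The rank of a level `i` in the order of the slopes: intersections of lines that branch at level
`i` have abscissa close to `slopeRank t i`. Levels from `t` on keep their order, the levels below
`t` come after all of them, in reversed order. -/
def slopeRank (t : ℕ) (i : Fin N) : ℕ := if t ≤ i then i else 2 * N - i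

theorem slopeRank_lt_iff {t : ℕ} {i j : Fin N} : slopeRank t i < slopeRank t j ↔
    (t ≤ (i : ℕ) ∧ ((j : ℕ) < t ∨ (i : ℕ) < j)) ∨ ((i : ℕ) < t ∧ (j : ℕ) < t ∧ (j : ℕ) < i) := by
  have hi := i.isLt
  have hj := j.isLt
  unfold slopeRank
  split_ifs <;> omega

theorem slopeRank_injective (t : ℕ) : Function.Injective (slopeRank t : Fin N → ℕ) := by
  intro i j h
  have h1 := (slopeRank_lt_iff (t := t) (i := i) (j := j)).not.1 h.not_lt
  have h2 := (slopeRank_lt_iff (t := t) (i := j) (j := i)).not.1 h.symm.not_lt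
  ext
  omega

theorem slopeRank_le (t : ℕ) (i : Fin N) : slopeRank t i ≤ 2 * N := by
  have hi := i.isLt
  unfold slopeRank
  split_ifs <;> omega

/-- The slope of the line of the word `w`. The base is large enough for the leading digit at which
two words differ to dominate. -/
noncomputable def wordSlope (w : Finset (Fin N)) : ℝ := ∑ i ∈ w, (4 * (N : ℝ) + 3) ^ (i : ℕ)

/-- The line `y = a * x + b` of the word `w`. Each level `i` contributes to `-b` its contribution to the
slope `a`, times `slopeRank t i`, so that two lines meet near the rank of their branching level. -/
noncomputable def wordLine (t : ℕ) (w : Finset (Fin N)) : ℝ × ℝ :=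
  (wordSlope w, -∑ i ∈ w, (slopeRank t i : ℝ) * (4 * (N : ℝ) + 3) ^ (i : ℕ))

theorem sum_lower_levels_mul_le (i : Fin N) :
    (∑ j ∈ Finset.univ.filter (· < i), (4 * (N : ℝ) + 3) ^ (j : ℕ)) * (4 * N + 2) ≤
      (4 * (N : ℝ) + 3) ^ (i : ℕ) := by
  have h1 : ∑ j ∈ Finset.univ.filter (· < i), (4 * (N : ℝ) + 3) ^ (j : ℕ) ≤
      ∑ j ∈ Finset.range i, (4 * (N : ℝ) + 3) ^ j := by
    rw [← Finset.sum_image (f := fun j : ℕ => (4 * (N : ℝ) + 3) ^ j) (g := fun j : Fin N => (j : ℕ))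
      (fun a _ b _ h => Fin.ext h)]
    refine Finset.sum_le_sum_of_subset_of_nonneg (fun k hk => ?_) fun _ _ _ => by positivity
    obtain ⟨j, hj, rfl⟩ := Finset.mem_image.1 hk
    exact Finset.mem_range.2 (Finset.mem_filter.1 hj).2
  have h2 := geom_sum_mul (4 * (N : ℝ) + 3) i
  have h3 : 4 * (N : ℝ) + 3 - 1 = 4 * N + 2 := by ring
  rw [h3] at h2
  have h4 : (0 : ℝ) ≤ 4 * N + 2 := by positivity
  nlinarith [mul_le_mul_of_nonneg_right h1 h4]

theorem BranchAt.lower_levels_lt (h : BranchAt i x y) :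
    4 * N * (∑ j ∈ Finset.univ.filter (· < i), (4 * (N : ℝ) + 3) ^ (j : ℕ)) <
      wordSlope y - wordSlope x := by
  have h1 := sum_lower_levels_mul_le i
  have h2 := h.abs_sum_sub_sum_sub_le fun j => (4 * (N : ℝ) + 3) ^ (j : ℕ)
  have h3 : ∀ j : Fin N, |(4 * (N : ℝ) + 3) ^ (j : ℕ)| = (4 * (N : ℝ) + 3) ^ (j : ℕ) :=
    fun j => abs_of_nonneg (by positivity)
  simp only [h3] at h2
  have h4 := (abs_le.1 h2).1
  have h5 : (0 : ℝ) < (4 * (N : ℝ) + 3) ^ (i : ℕ) := by positivity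
  have h6 : 0 ≤ ∑ j ∈ Finset.univ.filter (· < i), (4 * (N : ℝ) + 3) ^ (j : ℕ) :=
    Finset.sum_nonneg fun _ _ => by positivity
  simp only [wordSlope]
  set E := ∑ j ∈ Finset.univ.filter (· < i), (4 * (N : ℝ) + 3) ^ (j : ℕ)
  rcases h6.eq_or_lt with h6 | h6
  · rw [← h6] at h4 ⊢
    linarith
  · linarith

theorem BranchAt.wordSlope_lt (h : BranchAt i x y) : wordSlope x < wordSlope y := by
  have h1 := h.lower_levels_lt
  have : 0 ≤ 4 * (N : ℝ) * (∑ j ∈ Finset.univ.filter (· < i), (4 * (N : ℝ) + 3) ^ (j : ℕ)) :=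
    mul_nonneg (by positivity) (Finset.sum_nonneg fun _ _ => by positivity)
  linarith

theorem wordSlope_injective : Function.Injective (wordSlope : Finset (Fin N) → ℝ) := by
  intro x y h
  by_contra hne
  rcases exists_branchAt hne with ⟨i, hi⟩ | ⟨i, hi⟩
  · exact hi.wordSlope_lt.ne h
  · exact hi.wordSlope_lt.ne' h

theorem wordLine_injective (t : ℕ) : Function.Injective (wordLine t : Finset (Fin N) → ℝ × ℝ) :=
  fun _ _ h => wordSlope_injective (congrArg Prod.fst h)

theorem BranchAt.abs_meet_sub_lt (h : BranchAt i x y) (t : ℕ) :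
    |meet (wordLine t x) (wordLine t y) - slopeRank t i| < 1 / 2 := by
  have hlow := h.lower_levels_lt
  have hpos := sub_pos.2 h.wordSlope_lt
  have hsum := h.abs_sum_sub_sum_sub_le fun j =>
    ((slopeRank t j : ℝ) - slopeRank t i) * (4 * (N : ℝ) + 3) ^ (j : ℕ)
  have hb : ∑ j ∈ Finset.univ.filter (· < i),
      |((slopeRank t j : ℝ) - slopeRank t i) * (4 * (N : ℝ) + 3) ^ (j : ℕ)| ≤
      2 * N * ∑ j ∈ Finset.univ.filter (· < i), (4 * (N : ℝ) + 3) ^ (j : ℕ) := by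
    rw [Finset.mul_sum]
    refine Finset.sum_le_sum fun j _ => ?_
    rw [abs_mul, abs_of_nonneg (show (0 : ℝ) ≤ (4 * (N : ℝ) + 3) ^ (j : ℕ) by positivity)]
    refine mul_le_mul_of_nonneg_right ?_ (by positivity)
    have h1 : (slopeRank t j : ℝ) ≤ 2 * N := by exact_mod_cast slopeRank_le t j
    have h2 : (slopeRank t i : ℝ) ≤ 2 * N := by exact_mod_cast slopeRank_le t i
    have h3 : (0 : ℝ) ≤ slopeRank t j := by positivity
    have h4 : (0 : ℝ) ≤ slopeRank t i := by positivity
    rw [abs_le]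
    constructor <;> linarith
  have hexp : ∀ w : Finset (Fin N), ∑ j ∈ w,
      ((slopeRank t j : ℝ) - slopeRank t i) * (4 * (N : ℝ) + 3) ^ (j : ℕ) =
      -(wordLine t w).2 - slopeRank t i * wordSlope w := fun w => by
    simp only [wordLine, wordSlope, sub_mul, Finset.sum_sub_distrib, Finset.mul_sum, neg_neg]
  simp only [hexp, sub_self, zero_mul, sub_zero] at hsum
  have hm : meet (wordLine t x) (wordLine t y) - slopeRank t i =
      (-(wordLine t y).2 - slopeRank t i * wordSlope y -
        (-(wordLine t x).2 - slopeRank t i * wordSlope x)) / (wordSlope y - wordSlope x) := by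
    rw [eq_div_iff hpos.ne', meet, sub_mul]
    change _ / (wordSlope y - wordSlope x) * _ - _ = _
    rw [div_mul_cancel₀ _ hpos.ne']
    ring
  rw [hm, abs_div, abs_of_pos hpos, div_lt_iff₀ hpos]
  linarith

theorem BranchAt.meet_lt_meet_iff (h : BranchAt i x y) (h' : BranchAt j y z) (t : ℕ) :
    meet (wordLine t x) (wordLine t y) < meet (wordLine t y) (wordLine t z) ↔
      slopeRank t i < slopeRank t j := by
  have h1 := abs_lt.1 (h.abs_meet_sub_lt t)
  have h2 := abs_lt.1 (h'.abs_meet_sub_lt t)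
  constructor
  · intro hlt
    have hne : slopeRank t i ≠ slopeRank t j :=
      fun he => h.level_ne h' (slopeRank_injective t he)
    by_contra! hle
    have : (slopeRank t j : ℝ) + 1 ≤ slopeRank t i := by
      exact_mod_cast Nat.succ_le_of_lt (lt_of_le_of_ne hle hne.symm)
    linarith
  · intro hlt
    have : (slopeRank t i : ℝ) + 1 ≤ slopeRank t j := by
      exact_mod_cast Nat.succ_le_of_lt hlt
    linarith

theorem BranchAt.meet_gt_meet_iff (h : BranchAt i x y) (h' : BranchAt j y z) (t : ℕ) :
    meet (wordLine t y) (wordLine t z) < meet (wordLine t x) (wordLine t y) ↔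
      slopeRank t j < slopeRank t i := by
  have h1 := abs_lt.1 (h.abs_meet_sub_lt t)
  have h2 := abs_lt.1 (h'.abs_meet_sub_lt t)
  constructor
  · intro hlt
    have hne : slopeRank t i ≠ slopeRank t j :=
      fun he => h.level_ne h' (slopeRank_injective t he)
    by_contra! hle
    have : (slopeRank t i : ℝ) + 1 ≤ slopeRank t j := by
      exact_mod_cast Nat.succ_le_of_lt (lt_of_le_of_ne hle hne)
    linarith
  · intro hlt
    have : (slopeRank t j : ℝ) + 1 ≤ slopeRank t i := by
      exact_mod_cast Nat.succ_le_of_lt hlt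
    linarith

/-- The smallest word of a set. -/
theorem exists_first_word {C : Finset (Finset (Fin N))} (hC : C.Nonempty) :
    ∃ c ∈ C, ∀ x ∈ C, x ≠ c → ∃ i, BranchAt i c x := by
  obtain ⟨c, hc, hmin⟩ := C.exists_min_image wordSlope hC
  refine ⟨c, hc, fun x hx hne => ?_⟩
  rcases exists_branchAt hne with ⟨i, hi⟩ | h
  · exact absurd hi.wordSlope_lt (hmin x hx).not_gt
  · exact h

/-- The largest word of a set. -/
theorem exists_last_word {C : Finset (Finset (Fin N))} (hC : C.Nonempty) :
    ∃ c ∈ C, ∀ x ∈ C, x ≠ c → ∃ i, BranchAt i x c := by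
  obtain ⟨c, hc, hmax⟩ := C.exists_max_image wordSlope hC
  refine ⟨c, hc, fun x hx hne => ?_⟩
  rcases exists_branchAt hne with h | ⟨i, hi⟩
  · exact h
  · exact absurd hi.wordSlope_lt (hmax x hx).not_gt

/-- The lines of distinct words are in general position. -/
theorem generalPosition_wordLines [DecidableEq (AffineSubspace ℝ (ℝ × ℝ))] (t : ℕ)
    (W : Finset (Finset (Fin N))) :
    GeneralPosition (W.image fun w => graphLine (wordLine t w)) := by
  constructor
  · intro l hl
    obtain ⟨w, -, rfl⟩ := Finset.mem_image.1 hl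
    exact isLine_graphLine _
  · intro l hl
    obtain ⟨w, -, rfl⟩ := Finset.mem_image.1 hl
    exact not_isVertical_graphLine _
  · intro l hl m hm hne hpar
    obtain ⟨v, -, rfl⟩ := Finset.mem_image.1 hl
    obtain ⟨w, -, rfl⟩ := Finset.mem_image.1 hm
    exact hne (by rw [wordSlope_injective (graphLine_parallel_iff.1 hpar)])
  · intro l₁ h₁ l₂ h₂ l₃ h₃ h12 h13 h23 ⟨p, hp1, hp2, hp3⟩
    obtain ⟨u, -, rfl⟩ := Finset.mem_image.1 h₁
    obtain ⟨v, -, rfl⟩ := Finset.mem_image.1 h₂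
    obtain ⟨w, -, rfl⟩ := Finset.mem_image.1 h₃
    have hne : ∀ {a b : Finset (Fin N)}, graphLine (wordLine t a) ≠ graphLine (wordLine t b) →
        a ≠ b := fun h h' => h (by rw [h'])
    have hmeet : ∀ {a b : Finset (Fin N)}, p ∈ graphLine (wordLine t a) →
        p ∈ graphLine (wordLine t b) → ∀ {i}, BranchAt i a b →
        meet (wordLine t a) (wordLine t b) = p.1 := fun ha hb i hi =>
      meet_eq_of_lineVal_eq hi.wordSlope_lt ((mem_graphLine.1 ha).symm.trans (mem_graphLine.1 hb))
    have key : ∀ {a b c : Finset (Fin N)}, p ∈ graphLine (wordLine t a) →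
        p ∈ graphLine (wordLine t b) → p ∈ graphLine (wordLine t c) →
        ∀ {i j}, BranchAt i a b → BranchAt j b c → False := fun ha hb hc i j hi hj => by
      have h1 := hmeet ha hb hi
      have h2 := hmeet hb hc hj
      rcases lt_trichotomy (slopeRank t i) (slopeRank t j) with h | h | h
      · exact ((hi.meet_lt_meet_iff hj t).2 h).ne (h1.trans h2.symm)
      · exact hi.level_ne hj (slopeRank_injective t h)
      · exact ((hi.meet_gt_meet_iff hj t).2 h).ne (h2.trans h1.symm)
    rcases exists_branchAt (hne h12) with ⟨i, hi⟩ | ⟨i, hi⟩ <;>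
    rcases exists_branchAt (hne h23) with ⟨j, hj⟩ | ⟨j, hj⟩ <;>
    rcases exists_branchAt (hne h13) with ⟨k, hk⟩ | ⟨k, hk⟩ <;>
    first
      | exact key hp1 hp2 hp3 hi hj
      | exact key hp3 hp2 hp1 hj hi
      | exact key hp1 hp3 hp2 hk hj
      | exact key hp2 hp1 hp3 hi hk
      | exact key hp2 hp3 hp1 hj hk
      | exact key hp3 hp1 hp2 hk hi

end Words

/-! ### Cells bounded by lines of binary words -/

section CellRules

variable {N t : ℕ}

/-- Restrictions on increasing triples of words that hold when the lines of the words in `C`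
bound a common cell from above and those of the words in `D` from below: whether a triple is a cup
or a cap is determined by which of its members belong to `C` and which to `D`. The letters `c` and
`d` in a field name say to which set the three words belong, in increasing order. -/
structure CellRules (t : ℕ) (C D : Finset (Finset (Fin N))) : Prop where
  disjoint : Disjoint C D
  ccc : ∀ {x y z i j}, x ∈ C → y ∈ C → z ∈ C → BranchAt i x y → BranchAt j y z →
    slopeRank t j < slopeRank t i
  cdd : ∀ {x y z i j}, x ∈ C → y ∈ D → z ∈ D → BranchAt i x y → BranchAt j y z →
    slopeRank t j < slopeRank t i
  ddc : ∀ {x y z i j}, x ∈ D → y ∈ D → z ∈ C → BranchAt i x y → BranchAt j y z →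
    slopeRank t j < slopeRank t i
  dcc : ∀ {x y z i j}, x ∈ D → y ∈ C → z ∈ C → BranchAt i x y → BranchAt j y z →
    slopeRank t i < slopeRank t j
  ccd : ∀ {x y z i j}, x ∈ C → y ∈ C → z ∈ D → BranchAt i x y → BranchAt j y z →
    slopeRank t i < slopeRank t j
  ddd : ∀ {x y z i j}, x ∈ D → y ∈ D → z ∈ D → BranchAt i x y → BranchAt j y z →
    slopeRank t i < slopeRank t j

/-- A family of word lines that bounds a cell obeys the cell rules. -/
theorem BoundsCell.cellRules {G : Finset (Finset (Fin N))} {U : Set (ℝ × ℝ)}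
    [DecidableEq (ℝ × ℝ)] [DecidablePred fun w : Finset (Fin N) => wordLine t w ∈ U]
    (h : BoundsCell (G.image (wordLine t)) U) :
    CellRules t (G.filter fun w => wordLine t w ∈ U) (G.filter fun w => ¬ wordLine t w ∈ U) := by
  have hI : Set.InjOn Prod.fst ((G.image (wordLine t) : Finset (ℝ × ℝ)) : Set (ℝ × ℝ)) := by
    intro l hl m hm hlm
    obtain ⟨v, -, rfl⟩ := Finset.mem_image.1 (Finset.mem_coe.1 hl)
    obtain ⟨w, -, rfl⟩ := Finset.mem_image.1 (Finset.mem_coe.1 hm)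
    rw [wordSlope_injective hlm]
  rw [boundsCell_iff hI] at h
  have hb : ∀ {a b c}, a ∈ G → b ∈ G → c ∈ G → IsLowerBound U (wordLine t a) (wordLine t b) →
      IsUpperBound U (wordLine t a) (wordLine t c) →
      meet (wordLine t a) (wordLine t b) < meet (wordLine t a) (wordLine t c) :=
    fun ha hb hc => h _ (Finset.mem_image_of_mem _ ha) _ (Finset.mem_image_of_mem _ hb) _
      (Finset.mem_image_of_mem _ hc)
  refine ⟨Finset.disjoint_filter_filter_not _ _ _, ?_, ?_, ?_, ?_, ?_, ?_⟩ <;>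
  intro x y z i j hx hy hz hi hj <;>
  obtain ⟨hxG, hx⟩ := Finset.mem_filter.1 hx <;>
  obtain ⟨hyG, hy⟩ := Finset.mem_filter.1 hy <;>
  obtain ⟨hzG, hz⟩ := Finset.mem_filter.1 hz <;>
  have hxy : (wordLine t x).1 < (wordLine t y).1 := hi.wordSlope_lt <;>
  have hyz : (wordLine t y).1 < (wordLine t z).1 := hj.wordSlope_lt
  · rw [← hi.meet_gt_meet_iff hj, meet_comm (wordLine t x)]
    exact hb hyG hzG hxG (Or.inr ⟨hyz, hz⟩) (Or.inl ⟨hxy, hx⟩)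
  · rw [← hi.meet_gt_meet_iff hj, ← meet_gt_meet_right_iff hxy hyz, meet_comm (wordLine t x),
      meet_comm (wordLine t y)]
    exact hb hzG hyG hxG (Or.inl ⟨hyz, hy⟩) (Or.inl ⟨hxy.trans hyz, hx⟩)
  · rw [← hi.meet_gt_meet_iff hj, ← meet_gt_meet_left_iff hxy hyz]
    exact hb hxG hzG hyG (Or.inr ⟨hxy.trans hyz, hz⟩) (Or.inr ⟨hxy, hy⟩)
  · rw [← hi.meet_lt_meet_iff hj, ← meet_lt_meet_right_iff hxy hyz, meet_comm (wordLine t x),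
      meet_comm (wordLine t y)]
    exact hb hzG hxG hyG (Or.inl ⟨hxy.trans hyz, hx⟩) (Or.inl ⟨hyz, hy⟩)
  · rw [← hi.meet_lt_meet_iff hj, ← meet_lt_meet_left_iff hxy hyz]
    exact hb hxG hyG hzG (Or.inr ⟨hxy, hy⟩) (Or.inr ⟨hxy.trans hyz, hz⟩)
  · rw [← hi.meet_lt_meet_iff hj, meet_comm (wordLine t x)]
    exact hb hyG hxG hzG (Or.inl ⟨hxy, hx⟩) (Or.inr ⟨hyz, hz⟩)

theorem mem_image_compl {C : Finset (Finset (Fin N))} {x : Finset (Fin N)} :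
    x ∈ C.image compl ↔ xᶜ ∈ C := by
  rw [Finset.mem_image]
  exact ⟨fun ⟨y, hy, h⟩ => by rwa [← h, compl_compl], fun h => ⟨_, h, compl_compl x⟩⟩

/-- Complementing all words turns the plane of points dual to the lines by a half turn; it reverses
the order and exchanges the two sides of the cell. -/
theorem CellRules.compl {C D : Finset (Finset (Fin N))} (h : CellRules t C D) :
    CellRules t (D.image compl) (C.image compl) := by
  refine ⟨?_, ?_, ?_, ?_, ?_, ?_, ?_⟩
  · rw [Finset.disjoint_left]
    intro x hx hx'
    exact Finset.disjoint_left.1 h.disjoint (mem_image_compl.1 hx') (mem_image_compl.1 hx)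
  all_goals
    intro x y z i j hx hy hz hi hj
    rw [mem_image_compl] at hx hy hz
    rw [← branchAt_compl] at hi hj
  · exact h.ddd hz hy hx hj hi
  · exact h.ccd hz hy hx hj hi
  · exact h.dcc hz hy hx hj hi
  · exact h.ddc hz hy hx hj hi
  · exact h.cdd hz hy hx hj hi
  · exact h.ccc hz hy hx hj hi

/-- Two words are in the same cluster if they agree at all levels from `t` on. -/
def SameCluster (t : ℕ) (x y : Finset (Fin N)) : Prop := ∀ j : Fin N, t ≤ j → (j ∈ x ↔ j ∈ y)

section SameCluster

variable {i : Fin N} {x y z : Finset (Fin N)}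

theorem SameCluster.refl (x : Finset (Fin N)) : SameCluster t x x := fun _ _ => Iff.rfl

theorem SameCluster.symm (h : SameCluster t x y) : SameCluster t y x := fun j hj => (h j hj).symm

theorem SameCluster.trans (h : SameCluster t x y) (h' : SameCluster t y z) : SameCluster t x z :=
  fun j hj => (h j hj).trans (h' j hj)

theorem ne_of_not_sameCluster (h : ¬ SameCluster t x y) : x ≠ y := by
  rintro rfl
  exact h (SameCluster.refl x)

theorem sameCluster_compl : SameCluster t xᶜ yᶜ ↔ SameCluster t x y := by
  simp [SameCluster, not_iff_not]

theorem BranchAt.sameCluster_iff (h : BranchAt i x y) : SameCluster t x y ↔ (i : ℕ) < t := by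
  constructor
  · intro hs
    by_contra! hle
    exact h.1 ((hs i hle).2 h.2.1)
  · intro hi j hj
    exact h.2.2 j (Fin.lt_def.2 (by omega))

theorem BranchAt.congr_left (h : BranchAt i x y) (hi : t ≤ i) (hs : SameCluster t x z) :
    BranchAt i z y :=
  ⟨fun hz => h.1 ((hs i hi).2 hz), h.2.1, fun j hj =>
    (hs j (hi.trans (Fin.lt_def.1 hj).le)).symm.trans (h.2.2 j hj)⟩

theorem BranchAt.congr_right (h : BranchAt i x y) (hi : t ≤ i) (hs : SameCluster t y z) :
    BranchAt i x z :=
  ⟨h.1, (hs i hi).1 h.2.1, fun j hj =>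
    (h.2.2 j hj).trans (hs j (hi.trans (Fin.lt_def.1 hj).le))⟩

end SameCluster

/-- The words of `C` in the cluster of its first word `c` branch off `c` at different levels, at
which `c` has the digit zero. -/
theorem CellRules.card_cluster_le {C D T : Finset (Finset (Fin N))} (h : CellRules t C D)
    {c : Finset (Fin N)} (hc : c ∈ C) (hTC : T ⊆ C)
    (hT : ∀ x ∈ T, ∃ i : Fin N, BranchAt i c x ∧ (i : ℕ) < t) :
    T.card ≤ (cᶜ.filter fun i : Fin _ => (i : ℕ) < t).card := by
  have key : ∀ {x y} {i j : Fin N}, x ∈ T → y ∈ T → (i : ℕ) < t → BranchAt i c x → BranchAt i c y →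
      ¬ BranchAt j x y := by
    intro x y i j hx hy hit hix hiy hj
    have h1 := h.ccc hc (hTC hx) (hTC hy) hix hj
    rw [slopeRank_lt_iff] at h1
    rcases hix.trans hj with ⟨h3, h4⟩ | ⟨h3, h4⟩
    · have := hiy.level_unique h4
      omega
    · omega
  refine Finset.card_le_card_of_forall_subsingleton (fun x i => BranchAt i c x)
    (fun x hx => ?_) fun i hi x hx y hy => ?_
  · obtain ⟨i, hi, hit⟩ := hT x hx
    exact ⟨i, Finset.mem_filter.2 ⟨Finset.mem_compl.2 hi.1, hit⟩, hi⟩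
  · have hit := (Finset.mem_filter.1 hi).2
    by_contra hne
    rcases exists_branchAt hne with ⟨j, hj⟩ | ⟨j, hj⟩
    · exact key hx.1 hy.1 hit hx.2 hy.2 hj
    · exact key hy.1 hx.1 hit hy.2 hx.2 hj

/-- Words of `C` in pairwise different clusters branch off the last one of them at different levels,
at which that word has the digit one. -/
theorem CellRules.card_clusters_le {C D T : Finset (Finset (Fin N))} (h : CellRules t C D)
    {c : Finset (Fin N)} (hc : c ∈ C) (hTC : T ⊆ C)
    (hT : ∀ x ∈ T, ∃ i : Fin N, BranchAt i x c ∧ t ≤ (i : ℕ))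
    (hTT : ∀ x ∈ T, ∀ y ∈ T, ∀ i : Fin N, BranchAt i x y → t ≤ (i : ℕ)) :
    T.card ≤ (c.filter fun i : Fin _ => t ≤ (i : ℕ)).card := by
  have key : ∀ {x y} {i j : Fin N}, x ∈ T → y ∈ T → t ≤ (i : ℕ) → BranchAt i x c → BranchAt i y c →
      ¬ BranchAt j x y := by
    intro x y i j hx hy hit hix hiy hj
    have h1 := h.ccc (hTC hx) (hTC hy) hc hj hiy
    have h2 := hTT x hx y hy j hj
    rw [slopeRank_lt_iff] at h1
    rcases hj.trans hiy with ⟨h3, h4⟩ | ⟨h3, h4⟩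
    · omega
    · have := hix.level_unique h4
      omega
  refine Finset.card_le_card_of_forall_subsingleton (fun x i => BranchAt i x c)
    (fun x hx => ?_) fun i hi x hx y hy => ?_
  · obtain ⟨i, hi, hit⟩ := hT x hx
    exact ⟨i, Finset.mem_filter.2 ⟨hi.2.1, hit⟩, hi⟩
  · have hit := (Finset.mem_filter.1 hi).2
    by_contra hne
    rcases exists_branchAt hne with ⟨j, hj⟩ | ⟨j, hj⟩
    · exact key hx.1 hy.1 hit hx.2 hy.2 hj
    · exact key hy.1 hx.1 hit hy.2 hx.2 hj

open Classical in
/-- The words of `C` decompose into the cluster of the first word and words in pairwise different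
clusters; the sizes of both parts are bounded by numbers of digits. -/
theorem CellRules.exists_first {C D : Finset (Finset (Fin N))} (h : CellRules t C D) {a b : ℕ}
    (ha : ∀ x ∈ C, (x.filter fun i : Fin _ => t ≤ (i : ℕ)).card ≤ a)
    (hb : ∀ x ∈ C, (xᶜ.filter fun i : Fin _ => (i : ℕ) < t).card ≤ b) (hC : C.Nonempty) :
    ∃ c ∈ C, (∀ x ∈ C, x ≠ c → ∃ i, BranchAt i c x) ∧
      (C.filter fun x => SameCluster t c x).card ≤ b + 1 ∧
      (C.filter fun x => ¬ SameCluster t c x).card ≤ a := by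
  obtain ⟨c, hc, hmin⟩ := exists_first_word hC
  refine ⟨c, hc, hmin, ?_, ?_⟩
  · have hcC₁ : c ∈ C.filter fun x => SameCluster t c x :=
      Finset.mem_filter.2 ⟨hc, SameCluster.refl c⟩
    rw [← Finset.card_erase_add_one hcC₁]
    refine Nat.succ_le_succ (le_trans (h.card_cluster_le hc
      ((Finset.erase_subset _ _).trans (Finset.filter_subset _ _)) fun x hx => ?_) (hb c hc))
    have hx' := Finset.mem_erase.1 hx
    have hx'' := Finset.mem_filter.1 hx'.2
    obtain ⟨i, hi⟩ := hmin x hx''.1 hx'.1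
    exact ⟨i, hi, hi.sameCluster_iff.1 hx''.2⟩
  · set C₂ := C.filter fun x => ¬ SameCluster t c x with hC₂
    rcases C₂.eq_empty_or_nonempty with h0 | h0
    · rw [h0]; simp
    have hC₂C : ∀ {x}, x ∈ C₂ → x ∈ C ∧ ∃ i : Fin N, BranchAt i c x ∧ t ≤ (i : ℕ) := fun {x} hx => by
      have hx' := Finset.mem_filter.1 hx
      obtain ⟨i, hi⟩ := hmin x hx'.1 (ne_of_not_sameCluster hx'.2).symm
      exact ⟨hx'.1, i, hi, not_lt.1 (hi.sameCluster_iff.not.1 hx'.2)⟩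
    have hC₂C₂ : ∀ {x y} {j : Fin N}, x ∈ C₂ → y ∈ C₂ → BranchAt j x y → t ≤ (j : ℕ) :=
      fun {x y j} hx hy hj => by
        obtain ⟨hxC, i, hi, hit⟩ := hC₂C hx
        have h1 := h.ccc hc hxC (hC₂C hy).1 hi hj
        rw [slopeRank_lt_iff] at h1
        omega
    obtain ⟨q, hq, hmax⟩ := exists_last_word h0
    have hqC := hC₂C hq
    have hcC₂ : c ∉ C₂.erase q := fun hm =>
      (Finset.mem_filter.1 (Finset.mem_of_mem_erase hm)).2 (SameCluster.refl c)
    rw [← Finset.card_erase_add_one hq, ← Finset.card_insert_of_notMem hcC₂]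
    refine le_trans (h.card_clusters_le hqC.1 ?_ ?_ ?_) (ha q hqC.1)
    · exact Finset.insert_subset hc ((Finset.erase_subset _ _).trans (Finset.filter_subset _ _))
    · intro x hx
      rcases Finset.mem_insert.1 hx with rfl | hx
      · exact hqC.2
      · have hx' := Finset.mem_erase.1 hx
        obtain ⟨i, hi⟩ := hmax x hx'.2 hx'.1
        exact ⟨i, hi, hC₂C₂ hx'.2 hq hi⟩
    · intro x hx y hy i hi
      rcases Finset.mem_insert.1 hy with rfl | hy
      · rcases Finset.mem_insert.1 hx with rfl | hx
        · exact absurd rfl hi.ne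
        · obtain ⟨-, j, hj, -⟩ := hC₂C (Finset.mem_of_mem_erase hx)
          exact absurd hj.wordSlope_lt hi.wordSlope_lt.not_gt
      rcases Finset.mem_insert.1 hx with rfl | hx
      · obtain ⟨-, j, hj, hjt⟩ := hC₂C (Finset.mem_of_mem_erase hy)
        rwa [hi.level_unique hj]
      · exact hC₂C₂ (Finset.mem_of_mem_erase hx) (Finset.mem_of_mem_erase hy) hi

open Classical in
theorem CellRules.exists_last {C D : Finset (Finset (Fin N))} (h : CellRules t C D) {a b : ℕ}
    (ha : ∀ x ∈ D, (xᶜ.filter fun i : Fin _ => t ≤ (i : ℕ)).card ≤ a)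
    (hb : ∀ x ∈ D, (x.filter fun i : Fin _ => (i : ℕ) < t).card ≤ b) (hD : D.Nonempty) :
    ∃ d ∈ D, (∀ x ∈ D, x ≠ d → ∃ i, BranchAt i x d) ∧
      (D.filter fun x => SameCluster t d x).card ≤ b + 1 ∧
      (D.filter fun x => ¬ SameCluster t d x).card ≤ a := by
  obtain ⟨d, hd, hmax, h1, h2⟩ := h.compl.exists_first (a := a) (b := b)
    (fun x hx => by simpa only [compl_compl] using ha _ (mem_image_compl.1 hx))
    (fun x hx => hb _ (mem_image_compl.1 hx)) (hD.image _)
  refine ⟨dᶜ, mem_image_compl.1 hd, fun x hx hne => ?_, ?_, ?_⟩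
  · obtain ⟨i, hi⟩ := hmax xᶜ (mem_image_compl.2 (by rwa [compl_compl]))
      fun h => hne (by rw [← h, compl_compl])
    refine ⟨i, ?_⟩
    rwa [← branchAt_compl, compl_compl]
  · rw [Finset.filter_image, Finset.card_image_of_injective _ compl_injective] at h1
    refine le_trans (Finset.card_le_card fun x hx => ?_) h1
    rw [Finset.mem_filter] at hx ⊢
    refine ⟨hx.1, ?_⟩
    rw [← sameCluster_compl, compl_compl]
    exact hx.2
  · rw [Finset.filter_image, Finset.card_image_of_injective _ compl_injective] at h2
    refine le_trans (Finset.card_le_card fun x hx => ?_) h2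
    rw [Finset.mem_filter] at hx ⊢
    refine ⟨hx.1, ?_⟩
    rw [← sameCluster_compl, compl_compl]
    exact hx.2

/-- If a word of `D` precedes the words of `C` from another cluster, then those occupy at most two
clusters. -/
theorem CellRules.not_dccc {C D : Finset (Finset (Fin N))} (h : CellRules t C D)
    {d c₁ c₂ c₃ : Finset (Fin N)} {i j k : Fin N} (hd : d ∈ D) (h₁ : c₁ ∈ C) (h₂ : c₂ ∈ C)
    (h₃ : c₃ ∈ C) (hi : BranchAt i d c₁) (hj : BranchAt j c₁ c₂) (hk : BranchAt k c₂ c₃)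
    (hit : t ≤ (i : ℕ)) (hjt : t ≤ (j : ℕ)) : False := by
  have e1 := slopeRank_lt_iff.1 (h.dcc hd h₁ h₂ hi hj)
  have e2 := slopeRank_lt_iff.1 (h.ccc h₁ h₂ h₃ hj hk)
  rcases hi.trans hj with ⟨h3, h4⟩ | ⟨h3, h4⟩
  · have e3 := slopeRank_lt_iff.1 (h.dcc hd h₂ h₃ h4 hk)
    omega
  · omega

theorem CellRules.not_dddc {C D : Finset (Finset (Fin N))} (h : CellRules t C D)
    {d₁ d₂ d₃ c : Finset (Fin N)} {i j k : Fin N} (h₁ : d₁ ∈ D) (h₂ : d₂ ∈ D) (h₃ : d₃ ∈ D)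
    (hc : c ∈ C) (hi : BranchAt i d₁ d₂) (hj : BranchAt j d₂ d₃) (hk : BranchAt k d₃ c)
    (hjt : t ≤ (j : ℕ)) (hkt : t ≤ (k : ℕ)) : False :=
  h.compl.not_dccc (d := cᶜ) (c₁ := d₃ᶜ) (c₂ := d₂ᶜ) (c₃ := d₁ᶜ)
    (mem_image_compl.2 (by rwa [compl_compl])) (mem_image_compl.2 (by rwa [compl_compl]))
    (mem_image_compl.2 (by rwa [compl_compl])) (mem_image_compl.2 (by rwa [compl_compl]))
    (branchAt_compl.2 hk) (branchAt_compl.2 hj) (branchAt_compl.2 hi) hkt hjt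

theorem CellRules.not_ddcc {C D : Finset (Finset (Fin N))} (h : CellRules t C D)
    {d₁ d₂ c₁ c₂ : Finset (Fin N)} {i j k : Fin N} (h₁ : d₁ ∈ D) (h₂ : d₂ ∈ D) (h₃ : c₁ ∈ C)
    (h₄ : c₂ ∈ C) (hi : BranchAt i d₁ d₂) (hj : BranchAt j d₂ c₁) (hk : BranchAt k c₁ c₂)
    (hit : t ≤ (i : ℕ)) (hjt : t ≤ (j : ℕ)) (hkt : t ≤ (k : ℕ)) : False := by
  have e1 := slopeRank_lt_iff.1 (h.ddc h₁ h₂ h₃ hi hj)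
  have e2 := slopeRank_lt_iff.1 (h.dcc h₂ h₃ h₄ hj hk)
  rcases hi.trans hj with ⟨h3, h4⟩ | ⟨h3, h4⟩
  · omega
  rcases hj.trans hk with ⟨h5, h6⟩ | ⟨h5, h6⟩
  · have e3 := slopeRank_lt_iff.1 (h.dcc h₁ h₃ h₄ h4 hk)
    have e4 := slopeRank_lt_iff.1 (h.ddc h₁ h₂ h₄ hi h6)
    omega
  · omega

/-- Inside a cluster, a word of `D` cannot follow three words of `C`. Where words of `C` precede words
of `D` in a cluster, these are thus few. -/
theorem CellRules.not_cccd {C D : Finset (Finset (Fin N))} (h : CellRules t C D)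
    {c₁ c₂ c₃ d : Finset (Fin N)} {i j k : Fin N} (h₁ : c₁ ∈ C) (h₂ : c₂ ∈ C) (h₃ : c₃ ∈ C)
    (hd : d ∈ D) (hi : BranchAt i c₁ c₂) (hj : BranchAt j c₂ c₃) (hk : BranchAt k c₃ d)
    (hit : (i : ℕ) < t) (hkt : (k : ℕ) < t) : False := by
  have e1 := slopeRank_lt_iff.1 (h.ccc h₁ h₂ h₃ hi hj)
  have e2 := slopeRank_lt_iff.1 (h.ccd h₂ h₃ hd hj hk)
  rcases hj.trans hk with ⟨h3, h4⟩ | ⟨h3, h4⟩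
  · omega
  · have e3 := slopeRank_lt_iff.1 (h.ccd h₁ h₂ hd hi h4)
    omega

theorem CellRules.not_ccdd {C D : Finset (Finset (Fin N))} (h : CellRules t C D)
    {c₁ c₂ d₁ d₂ : Finset (Fin N)} {i j k : Fin N} (h₁ : c₁ ∈ C) (h₂ : c₂ ∈ C) (h₃ : d₁ ∈ D)
    (h₄ : d₂ ∈ D) (hi : BranchAt i c₁ c₂) (hj : BranchAt j c₂ d₁) (hk : BranchAt k d₁ d₂)
    (hit : (i : ℕ) < t) (hkt : (k : ℕ) < t) : False := by
  have e1 := slopeRank_lt_iff.1 (h.ccd h₁ h₂ h₃ hi hj)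
  have e2 := slopeRank_lt_iff.1 (h.cdd h₂ h₃ h₄ hj hk)
  rcases hj.trans hk with ⟨h3, h4⟩ | ⟨h3, h4⟩
  swap
  · omega
  rcases hi.trans hj with ⟨h5, h6⟩ | ⟨h5, h6⟩
  · omega
  · have e3 := slopeRank_lt_iff.1 (h.ccd h₁ h₂ h₄ hi h4)
    have e4 := slopeRank_lt_iff.1 (h.cdd h₁ h₃ h₄ h6 hk)
    omega

/-- The size of a cell in which two words of `C` share a cluster. Then either hardly any other
cluster occurs, or the words of `C` and `D` in that cluster are three in number. -/
theorem CellRules.card_le_of_cluster {C D : Finset (Finset (Fin N))} (h : CellRules t C D)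
    {a b a' b' M : ℕ}
    (ha : ∀ x ∈ C, (x.filter fun i : Fin _ => t ≤ (i : ℕ)).card ≤ a)
    (hb : ∀ x ∈ C, (xᶜ.filter fun i : Fin _ => (i : ℕ) < t).card ≤ b)
    (ha' : ∀ x ∈ D, (xᶜ.filter fun i : Fin _ => t ≤ (i : ℕ)).card ≤ a')
    (hb' : ∀ x ∈ D, (x.filter fun i : Fin _ => (i : ℕ) < t).card ≤ b')
    (hM₁ : b + b' + 3 ≤ M) (hM₂ : a + 4 ≤ M) (hM₃ : a' + 4 ≤ M)
    (hC : ∃ x ∈ C, ∃ y ∈ C, ∃ i : Fin N, BranchAt i x y ∧ (i : ℕ) < t) (hD : D.Nonempty) :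
    C.card + D.card ≤ M := by
  classical
  obtain ⟨u, hu, v, hv, i₀, hi₀, hi₀t⟩ := hC
  obtain ⟨c, hc, hmin, hc1, hc2⟩ := h.exists_first ha hb ⟨u, hu⟩
  obtain ⟨d, hd, hmax, hd1, hd2⟩ := h.exists_last ha' hb' hD
  rw [← Finset.card_filter_add_card_filter_not (s := C) (fun x => SameCluster t c x),
    ← Finset.card_filter_add_card_filter_not (s := D) (fun x => SameCluster t d x)]
  set C₁ := C.filter fun x => SameCluster t c x with hC₁
  set C₂ := C.filter fun x => ¬ SameCluster t c x with hC₂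
  set D₁ := D.filter fun x => SameCluster t d x with hD₁
  set D₂ := D.filter fun x => ¬ SameCluster t d x with hD₂
  -- another word of the cluster of `c`
  obtain ⟨e, he, i₁, hi₁, hi₁t⟩ : ∃ e ∈ C, ∃ i : Fin N, BranchAt i c e ∧ (i : ℕ) < t := by
    by_cases huc : u = c
    · exact ⟨v, hv, i₀, huc ▸ hi₀, hi₀t⟩
    · obtain ⟨k, hk⟩ := hmin u hu huc
      have := slopeRank_lt_iff.1 (h.ccc hc hu hv hk hi₀)
      exact ⟨u, hu, k, hk, by omega⟩
  have hce : SameCluster t c e := hi₁.sameCluster_iff.2 hi₁t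
  have hCmem : ∀ {x}, x ∈ C₂ → x ∈ C ∧ ∃ k : Fin N, BranchAt k c x ∧ t ≤ (k : ℕ) := fun {x} hx => by
    have hx' := Finset.mem_filter.1 hx
    obtain ⟨k, hk⟩ := hmin x hx'.1 (ne_of_not_sameCluster hx'.2).symm
    exact ⟨hx'.1, k, hk, not_lt.1 (hk.sameCluster_iff.not.1 hx'.2)⟩
  have hDmem : ∀ {x}, x ∈ D₂ → x ∈ D ∧ ∃ k : Fin N, BranchAt k x d ∧ t ≤ (k : ℕ) := fun {x} hx => by
    have hx' := Finset.mem_filter.1 hx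
    obtain ⟨k, hk⟩ := hmax x hx'.1 (ne_of_not_sameCluster hx'.2).symm
    exact ⟨hx'.1, k, hk, not_lt.1 (hk.sameCluster_iff.not.1 fun hs => hx'.2 hs.symm)⟩
  -- the steep line through `c` and `e` leaves the other clusters of `D` on its left
  have hleft : ∀ x ∈ D, ¬ SameCluster t c x → ∃ k : Fin N, BranchAt k x c ∧ t ≤ (k : ℕ) := by
    intro x hx hs
    rcases exists_branchAt (ne_of_not_sameCluster hs) with ⟨k, hk⟩ | ⟨k, hk⟩
    · have hkt := not_lt.1 (hk.sameCluster_iff.not.1 hs)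
      have := slopeRank_lt_iff.1 (h.ccd hc he hx hi₁ (hk.congr_left hkt hce))
      omega
    · exact ⟨k, hk, not_lt.1 (hk.sameCluster_iff.not.1 fun hs' => hs hs'.symm)⟩
  by_cases hfew : C₂.card + D₂.card ≤ 1
  · omega
  by_cases hcd : SameCluster t c d
  · -- the words of `C` in the common cluster precede those of `D`
    have hCD : ∀ x ∈ C₁, ∀ y ∈ D₁, ∃ k : Fin N, BranchAt k x y ∧ (k : ℕ) < t := by
      intro x hx y hy
      have hx' := Finset.mem_filter.1 hx
      have hy' := Finset.mem_filter.1 hy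
      have hxy : SameCluster t x y := hx'.2.symm.trans (hcd.trans hy'.2)
      have hxy' : x ≠ y := by
        rintro rfl
        exact Finset.disjoint_left.1 h.disjoint hx'.1 hy'.1
      rcases exists_branchAt hxy' with ⟨k, hk⟩ | ⟨k, hk⟩
      · exact ⟨k, hk, hk.sameCluster_iff.1 hxy⟩
      exfalso
      have hkt := hk.sameCluster_iff.1 hxy.symm
      rcases Nat.eq_zero_or_pos C₂.card with h0 | h0
      · obtain ⟨z, hz⟩ := Finset.card_pos.1 (show 0 < D₂.card by omega)
        obtain ⟨hzD, j, hj, hjt⟩ := hDmem hz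
        have := slopeRank_lt_iff.1 (h.ddc hzD hy'.1 hx'.1 (hj.congr_right hjt hy'.2) hk)
        omega
      · obtain ⟨z, hz⟩ := Finset.card_pos.1 h0
        obtain ⟨hzC, j, hj, hjt⟩ := hCmem hz
        have := slopeRank_lt_iff.1 (h.dcc hy'.1 hx'.1 hzC hk (hj.congr_left hjt hx'.2))
        omega
    have hcC₁ : c ∈ C₁ := Finset.mem_filter.2 ⟨hc, SameCluster.refl c⟩
    have heC₁ : e ∈ C₁ := Finset.mem_filter.2 ⟨he, hce⟩
    have hdD₁ : d ∈ D₁ := Finset.mem_filter.2 ⟨hd, SameCluster.refl d⟩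
    have hC₁card : C₁.card ≤ 2 := by
      by_contra! hlt
      have := Finset.card_erase_add_one hcC₁
      obtain ⟨x, hx, y, hy, j, hj⟩ := exists_branchAt_of_one_lt_card
        (show 1 < (C₁.erase c).card by omega)
      obtain ⟨hxc, hx⟩ := Finset.mem_erase.1 hx
      have hx' := Finset.mem_filter.1 hx
      have hy := Finset.mem_of_mem_erase hy
      obtain ⟨i, hi⟩ := hmin x hx'.1 hxc
      obtain ⟨k, hk, hkt⟩ := hCD y hy d hdD₁
      exact h.not_cccd hc hx'.1 (Finset.mem_filter.1 hy).1 hd hi hj hk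
        (hi.sameCluster_iff.1 hx'.2) hkt
    have hD₁card : D₁.card ≤ 1 := by
      by_contra! hlt
      have := Finset.card_erase_add_one hdD₁
      obtain ⟨x, hx⟩ := Finset.card_pos.1 (show 0 < (D₁.erase d).card by omega)
      obtain ⟨hxd, hx⟩ := Finset.mem_erase.1 hx
      have hx' := Finset.mem_filter.1 hx
      obtain ⟨j, hj, -⟩ := hCD e heC₁ x hx
      obtain ⟨k, hk⟩ := hmax x hx'.1 hxd
      exact h.not_ccdd hc he hx'.1 hd hi₁ hj hk hi₁t (hk.sameCluster_iff.1 hx'.2.symm)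
    rcases Nat.eq_zero_or_pos D₂.card with h0 | h0
    · omega
    have hC₂card : C₂.card ≤ 1 := by
      by_contra! hlt
      obtain ⟨z, hz⟩ := Finset.card_pos.1 h0
      obtain ⟨x, hx, y, hy, j, hj⟩ := exists_branchAt_of_one_lt_card hlt
      obtain ⟨hxC, k, hk, hkt⟩ := hCmem hx
      have hz' := Finset.mem_filter.1 hz
      obtain ⟨i, hi, hit⟩ := hleft z hz'.1 fun hs => hz'.2 (hcd.symm.trans hs)
      exact h.not_dccc hz'.1 hc hxC (hCmem hy).1 hi hk hj hit hkt
    omega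
  · exfalso
    obtain ⟨i, hi, hit⟩ := hleft d hd hcd
    rcases Nat.lt_or_ge 1 C₂.card with hlt | hle
    · obtain ⟨x, hx, y, hy, j, hj⟩ := exists_branchAt_of_one_lt_card hlt
      obtain ⟨hxC, k, hk, hkt⟩ := hCmem hx
      exact h.not_dccc hd hc hxC (hCmem hy).1 hi hk hj hit hkt
    rcases Nat.lt_or_ge 1 D₂.card with hlt | hle'
    · obtain ⟨x, hx, y, hy, j, hj⟩ := exists_branchAt_of_one_lt_card hlt
      obtain ⟨hyD, k, hk, hkt⟩ := hDmem hy
      exact h.not_dddc (hDmem hx).1 hyD hd hc hj hk hi hkt hit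
    obtain ⟨x, hx⟩ := Finset.card_pos.1 (show 0 < C₂.card by omega)
    obtain ⟨y, hy⟩ := Finset.card_pos.1 (show 0 < D₂.card by omega)
    obtain ⟨hxC, k, hk, hkt⟩ := hCmem hx
    obtain ⟨hyD, l, hl, hlt⟩ := hDmem hy
    exact h.not_ddcc hyD hd hc hxC hl hi hk hlt hit hkt

/-- The size of a cell bounded by word lines, in terms of bounds for numbers of digits. -/
theorem CellRules.card_le {C D : Finset (Finset (Fin N))} (h : CellRules t C D)
    {a b a' b' M : ℕ}
    (ha : ∀ x ∈ C, (x.filter fun i : Fin _ => t ≤ (i : ℕ)).card ≤ a)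
    (hb : ∀ x ∈ C, (xᶜ.filter fun i : Fin _ => (i : ℕ) < t).card ≤ b)
    (ha' : ∀ x ∈ D, (xᶜ.filter fun i : Fin _ => t ≤ (i : ℕ)).card ≤ a')
    (hb' : ∀ x ∈ D, (x.filter fun i : Fin _ => (i : ℕ) < t).card ≤ b')
    (hM₁ : b + b' + 3 ≤ M) (hM₂ : a + 4 ≤ M) (hM₃ : a' + 4 ≤ M) (hM₄ : a + a' + 2 ≤ M)
    (hM₅ : a + b + 1 ≤ M) (hM₆ : a' + b' + 1 ≤ M) : C.card + D.card ≤ M := by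
  classical
  have hCle : C.card ≤ a + b + 1 := by
    rcases C.eq_empty_or_nonempty with rfl | hC
    · simp
    obtain ⟨c, -, -, h1, h2⟩ := h.exists_first ha hb hC
    rw [← Finset.card_filter_add_card_filter_not (s := C) (fun x => SameCluster t c x)]
    omega
  have hDle : D.card ≤ a' + b' + 1 := by
    rcases D.eq_empty_or_nonempty with rfl | hD
    · simp
    obtain ⟨d, -, -, h1, h2⟩ := h.exists_last ha' hb' hD
    rw [← Finset.card_filter_add_card_filter_not (s := D) (fun x => SameCluster t d x)]
    omega
  rcases C.eq_empty_or_nonempty with rfl | hC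
  · simp only [Finset.card_empty]
    omega
  rcases D.eq_empty_or_nonempty with rfl | hD
  · simp only [Finset.card_empty]
    omega
  by_cases hCc : ∃ x ∈ C, ∃ y ∈ C, ∃ i : Fin N, BranchAt i x y ∧ (i : ℕ) < t
  · exact h.card_le_of_cluster ha hb ha' hb' hM₁ hM₂ hM₃ hCc hD
  by_cases hDc : ∃ x ∈ D, ∃ y ∈ D, ∃ i : Fin N, BranchAt i x y ∧ (i : ℕ) < t
  · have := h.compl.card_le_of_cluster (a := a') (b := b') (a' := a) (b' := b) (M := M)
      (fun x hx => by simpa only [compl_compl] using ha' _ (mem_image_compl.1 hx))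
      (fun x hx => hb' _ (mem_image_compl.1 hx))
      (fun x hx => ha _ (mem_image_compl.1 hx))
      (fun x hx => by simpa only [compl_compl] using hb _ (mem_image_compl.1 hx)) (by omega) hM₃ hM₂
      (by
        obtain ⟨x, hx, y, hy, i, hi, hit⟩ := hDc
        exact ⟨yᶜ, Finset.mem_image_of_mem _ hy, xᶜ, Finset.mem_image_of_mem _ hx, i,
          branchAt_compl.2 hi, hit⟩)
      (hC.image _)
    rw [Finset.card_image_of_injective _ compl_injective,
      Finset.card_image_of_injective _ compl_injective] at this
    omega
  -- if no two words of `C` or of `D` share a cluster, the first and last clusters are singletons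
  obtain ⟨c, hc, hmin, -, hc2⟩ := h.exists_first ha hb hC
  obtain ⟨d, hd, hmax, -, hd2⟩ := h.exists_last ha' hb' hD
  rw [← Finset.card_filter_add_card_filter_not (s := C) (fun x => SameCluster t c x),
    ← Finset.card_filter_add_card_filter_not (s := D) (fun x => SameCluster t d x)]
  have hc1 : (C.filter fun x => SameCluster t c x).card ≤ 1 := by
    by_contra! hlt
    obtain ⟨x, hx, y, hy, i, hi⟩ := exists_branchAt_of_one_lt_card hlt
    rw [Finset.mem_filter] at hx hy
    exact hCc ⟨x, hx.1, y, hy.1, i, hi, hi.sameCluster_iff.1 (hx.2.symm.trans hy.2)⟩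
  have hd1 : (D.filter fun x => SameCluster t d x).card ≤ 1 := by
    by_contra! hlt
    obtain ⟨x, hx, y, hy, i, hi⟩ := exists_branchAt_of_one_lt_card hlt
    rw [Finset.mem_filter] at hx hy
    exact hDc ⟨x, hx.1, y, hy.1, i, hi, hi.sameCluster_iff.1 (hx.2.symm.trans hy.2)⟩
  omega

end CellRules

/-! ### The lower bound -/

/-- The `N`-digit words with `α` ones among the levels from `t` on and `β` ones among the levels below `t`. -/
def balancedWords (N t α β : ℕ) : Finset (Finset (Fin N)) :=
  Finset.univ.filter fun w => (w.filter fun i : Fin _ => t ≤ (i : ℕ)).card = α ∧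
    (w.filter fun i : Fin _ => (i : ℕ) < t).card = β

theorem card_low_levels (s t : ℕ) :
    (Finset.univ.filter fun i : Fin (t + s) => (i : ℕ) < t).card = t := by
  rw [← Fintype.card_subtype, Fintype.card_congr (Fin.castLEquiv (Nat.le_add_right t s)).symm]
  simp

theorem card_high_levels (s t : ℕ) :
    (Finset.univ.filter fun i : Fin (t + s) => t ≤ (i : ℕ)).card = s := by
  have h := Finset.card_filter_add_card_filter_not (s := (Finset.univ : Finset (Fin (t + s))))
    (fun i : Fin (t + s) => (i : ℕ) < t)
  simp only [not_lt, card_low_levels, Finset.card_univ, Fintype.card_fin] at h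
  omega

theorem card_balancedWords (s t α β : ℕ) :
    s.choose α * t.choose β ≤ (balancedWords (t + s) t α β).card := by
  set H := Finset.univ.filter fun i : Fin (t + s) => t ≤ (i : ℕ) with hH
  set L := Finset.univ.filter fun i : Fin (t + s) => (i : ℕ) < t with hL
  have hcard : (H.powersetCard α ×ˢ L.powersetCard β).card = s.choose α * t.choose β := by
    rw [Finset.card_product, Finset.card_powersetCard, Finset.card_powersetCard, card_high_levels,
      card_low_levels]
  have hfilt : ∀ p ∈ H.powersetCard α ×ˢ L.powersetCard β,
      (p.1 ∪ p.2).filter (fun i : Fin _ => t ≤ (i : ℕ)) = p.1 ∧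
      (p.1 ∪ p.2).filter (fun i : Fin _ => (i : ℕ) < t) = p.2 := by
    intro p hp
    rw [Finset.mem_product, Finset.mem_powersetCard, Finset.mem_powersetCard] at hp
    have h1 : ∀ i ∈ p.1, t ≤ (i : ℕ) := fun i hi => (Finset.mem_filter.1 (hp.1.1 hi)).2
    have h2 : ∀ i ∈ p.2, (i : ℕ) < t := fun i hi => (Finset.mem_filter.1 (hp.2.1 hi)).2
    constructor
    · ext i
      simp only [Finset.mem_filter, Finset.mem_union]
      exact ⟨fun ⟨h, h'⟩ => h.resolve_right fun h'' => (h2 i h'').not_ge h',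
        fun h => ⟨Or.inl h, h1 i h⟩⟩
    · ext i
      simp only [Finset.mem_filter, Finset.mem_union]
      exact ⟨fun ⟨h, h'⟩ => h.resolve_left fun h'' => (h1 i h'').not_gt h',
        fun h => ⟨Or.inr h, h2 i h⟩⟩
  rw [← hcard]
  refine Finset.card_le_card_of_injOn (fun p => p.1 ∪ p.2) (fun p hp => ?_) fun p hp q hq hpq => ?_
  · have h := hfilt p hp
    have hp' := hp
    rw [Finset.mem_coe, Finset.mem_product, Finset.mem_powersetCard, Finset.mem_powersetCard] at hp'
    simp only [balancedWords, Finset.coe_filter, Finset.mem_univ, true_and, Set.mem_ofPred_eq]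
    rw [h.1, h.2]
    exact ⟨hp'.1.2, hp'.2.2⟩
  · have h1 := hfilt p hp
    have h2 := hfilt q hq
    simp only at hpq
    rw [hpq] at h1
    exact Prod.ext (h1.1.symm.trans h2.1) (h1.2.symm.trans h2.2)

/-- The lines of the balanced words do not span an `n`-cell, so that their number is a lower bound
for every sufficient size. The hypotheses on `m` say that `m = ⌈n / 2⌉ - 1`. -/
theorem not_spansCell_balancedWords [DecidableEq (AffineSubspace ℝ (ℝ × ℝ))] {n m : ℕ}
    (hm : 3 ≤ m) (hmn : 2 * m + 1 ≤ n) (hmn' : n ≤ 2 * m + 2) (hn : 8 ≤ n) :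
    ¬ SpansCell ((balancedWords ((n - 4) + (n - 3)) (n - 4) (m - 1) (m - 1)).image
      fun w => graphLine (wordLine (n - 4) w)) n := by
  classical
  rintro ⟨G, hG, hGn, hconv⟩
  obtain ⟨W, hW, rfl⟩ := Finset.subset_image_iff.1 hG
  rw [← Function.comp_def graphLine, ← Finset.image_image] at hconv
  have hinj : Function.Injective fun w : Finset (Fin ((n - 4) + (n - 3))) =>
      graphLine (wordLine (n - 4) w) := graphLine_injective.comp (wordLine_injective (n - 4))
  rw [Finset.card_image_of_injective _ hinj] at hGn
  obtain ⟨U, hU⟩ := hconv.exists_boundsCell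
  have hrules := hU.cellRules
  have hbal : ∀ x ∈ W, (x.filter fun i : Fin _ => n - 4 ≤ (i : ℕ)).card = m - 1 ∧
      (x.filter fun i : Fin _ => (i : ℕ) < n - 4).card = m - 1 := fun x hx =>
    (Finset.mem_filter.1 (hW hx)).2
  have hcompl : ∀ (x : Finset (Fin ((n - 4) + (n - 3)))) (p : Fin ((n - 4) + (n - 3)) → Prop)
      [DecidablePred p], (xᶜ.filter p).card + (x.filter p).card = (Finset.univ.filter p).card := by
    intro x p _
    rw [← Finset.card_union_of_disjoint, ← Finset.filter_union, Finset.union_comm,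
      Finset.union_compl]
    exact Finset.disjoint_filter_filter disjoint_compl_left
  have hle := hrules.card_le (a := m - 1) (b := n - m - 3) (a' := n - m - 2) (b' := m - 1)
    (M := n - 1)
    (fun x hx => (hbal x (Finset.mem_filter.1 hx).1).1.le)
    (fun x hx => by
      have h1 := hcompl x fun i : Fin _ => (i : ℕ) < n - 4
      rw [card_low_levels, (hbal x (Finset.mem_filter.1 hx).1).2] at h1
      omega)
    (fun x hx => by
      have h1 := hcompl x fun i : Fin _ => n - 4 ≤ (i : ℕ)
      rw [card_high_levels, (hbal x (Finset.mem_filter.1 hx).1).1] at h1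
      omega)
    (fun x hx => (hbal x (Finset.mem_filter.1 hx).1).2.le)
    (by omega) (by omega) (by omega) (by omega) (by omega) (by omega)
  rw [Finset.card_filter_add_card_filter_not, hGn] at hle
  omega

theorem two_mul_choose_sq_le {n m : ℕ} (hm : 3 ≤ m) (hmn : 2 * m + 1 ≤ n) (hmn' : n ≤ 2 * m + 2) :
    2 * (n - 4).choose m ^ 2 ≤ (n - 3).choose (m - 1) * (n - 4).choose (m - 1) := by
  obtain ⟨k, rfl⟩ : ∃ k, m = k + 3 := ⟨m - 3, by omega⟩
  have hpas : (n - 3).choose (k + 2) = (n - 4).choose (k + 1) + (n - 4).choose (k + 2) := by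
    rw [show n - 3 = (n - 4) + 1 by omega, Nat.choose_succ_succ]
  have h : (n - 4).choose (k + 3) ≤ (n - 4).choose (k + 2) ∧
      (n - 4).choose (k + 3) ≤ (n - 4).choose (k + 1) := by
    rcases (show n = 2 * k + 7 ∨ n = 2 * k + 8 by omega) with rfl | rfl
    · have h1 : (2 * k + 7 - 4).choose (k + 2) = (2 * k + 7 - 4).choose (k + 1) :=
        Nat.choose_symm_of_eq_add (by omega)
      have h2 := Nat.choose_le_middle (k + 3) (2 * k + 7 - 4)
      rw [show (2 * k + 7 - 4) / 2 = k + 1 by omega] at h2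
      exact ⟨h1 ▸ h2, h2⟩
    · have h1 : (2 * k + 8 - 4).choose (k + 3) = (2 * k + 8 - 4).choose (k + 1) :=
        Nat.choose_symm_of_eq_add (by omega)
      have h2 := Nat.choose_le_middle (k + 3) (2 * k + 8 - 4)
      rw [show (2 * k + 8 - 4) / 2 = k + 2 by omega] at h2
      exact ⟨h2, h1.le⟩
  rw [show k + 3 - 1 = k + 2 by omega, hpas]
  nlinarith [Nat.mul_le_mul h.1 h.1, Nat.mul_le_mul h.2 h.1]

/-- A family in general position that does not span an `n`-cell is smaller than every sufficient
size. -/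
theorem card_lt_of_not_spansCell {F : Finset (AffineSubspace ℝ (ℝ × ℝ))} {n N : ℕ}
    (hN : N ∈ sufficientSizes n) (hF : GeneralPosition F) (h : ¬ SpansCell F n) : F.card < N := by
  by_contra! hle
  exact h (hN F hF hle)

theorem two_le_of_mem_sufficientSizes {n N : ℕ} (hn : 2 ≤ n) (hN : N ∈ sufficientSizes n) :
    2 ≤ N := by
  classical
  have hgp := generalPosition_wordLines 0 ({∅} : Finset (Finset (Fin 0)))
  have hcard := card_lt_of_not_spansCell hN hgp (by
    rintro ⟨G, hG, hGn, -⟩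
    have := Finset.card_le_card hG
    simp at this
    omega)
  rw [Finset.image_singleton, Finset.card_singleton] at hcard
  exact hcard

theorem two_mul_choose_sq_le_of_mem_sufficientSizes {n N : ℕ} (hn : 3 ≤ n)
    (hN : N ∈ sufficientSizes n) :
    2 * Ring.choose ((n : ℤ) - 4) (⌈(n : ℝ) / 2⌉₊ - 1) ^ 2 ≤ (N : ℤ) := by
  classical
  have hceil : ⌈(n : ℝ) / 2⌉₊ = (n + 1) / 2 := by
    rw [Nat.ceil_eq_iff (by omega)]
    have h1 : n ≤ 2 * ((n + 1) / 2) := by omega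
    have h2 : 2 * ((n + 1) / 2 - 1) < n := by omega
    have h1' : (n : ℝ) ≤ 2 * ((n + 1) / 2 : ℕ) := by exact_mod_cast h1
    have h2' : 2 * (((n + 1) / 2 - 1 : ℕ) : ℝ) < n := by exact_mod_cast h2
    constructor <;> linarith
  rw [hceil]
  have h2 : (2 : ℤ) ≤ N := by exact_mod_cast two_le_of_mem_sufficientSizes (by omega) hN
  rcases hn.eq_or_lt with rfl | hn4
  · have : Ring.choose (((3 : ℕ) : ℤ) - 4) ((3 + 1) / 2 - 1) = -1 := by
      norm_num
    rw [this]
    linarith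
  have hcast : ((n : ℤ) - 4) = ((n - 4 : ℕ) : ℤ) := by
    rw [Nat.cast_sub (by omega)]
    rfl
  rw [hcast, Ring.choose_natCast]
  -- for `n < 8` the binomial coefficient is at most one, so that `2 ≤ N` suffices
  by_cases hn8 : 8 ≤ n
  swap
  · have : (n - 4).choose ((n + 1) / 2 - 1) ≤ 1 := by
      interval_cases n <;> decide
    have h' : ((n - 4).choose ((n + 1) / 2 - 1)) ^ 2 ≤ 1 := by
      rw [← one_pow 2]; exact Nat.pow_le_pow_left this 2
    have : (((n - 4).choose ((n + 1) / 2 - 1) : ℕ) : ℤ) ^ 2 ≤ 1 := by exact_mod_cast h'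
    linarith
  have hlt := card_lt_of_not_spansCell hN (generalPosition_wordLines _ _)
    (not_spansCell_balancedWords (n := n) (m := (n + 1) / 2 - 1) (by omega) (by omega) (by omega)
      hn8)
  have hinj : Function.Injective fun w : Finset (Fin ((n - 4) + (n - 3))) =>
      graphLine (wordLine (n - 4) w) := graphLine_injective.comp (wordLine_injective (n - 4))
  rw [Finset.card_image_of_injective _ hinj] at hlt
  have h3 := card_balancedWords (n - 3) (n - 4) ((n + 1) / 2 - 1 - 1) ((n + 1) / 2 - 1 - 1)
  have h4 := two_mul_choose_sq_le (n := n) (m := (n + 1) / 2 - 1) (by omega) (by omega) (by omega)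
  exact_mod_cast (h4.trans h3).trans hlt.le

theorem theorem1 (n : ℕ) (hn : 3 ≤ n) :
    IsLeast (sufficientSizes n) (ESl n) ∧
    2 * Ring.choose ((n : ℤ) - 4) (⌈(n : ℝ) / 2⌉₊ - 1) ^ 2 ≤ (ESl n : ℤ) ∧
    (4 ≤ n → ESl n ≤ Nat.choose (2 * n - 4) (n - 2)) := by
  have hne : (sufficientSizes n).Nonempty := by
    rcases hn.eq_or_lt with rfl | hn4
    · exact ⟨3, three_mem_sufficientSizes⟩
    · exact ⟨_, choose_mem_sufficientSizes hn4⟩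
  have hmem : ESl n ∈ sufficientSizes n := Nat.sInf_mem hne
  exact ⟨⟨hmem, fun _ hN => Nat.sInf_le hN⟩, two_mul_choose_sq_le_of_mem_sufficientSizes hn hmem,
    fun hn4 => Nat.sInf_le (choose_mem_sufficientSizes hn4)⟩
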